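/- Let $d\ge 3$, let $d/2\le s\le\infty$, and let $V\colon\mathbb R^d\to[0,\infty)$ be a locally integrable function, not a.e. zero, in the reverse Hölder class $RH_s(\mathbb R^d)$: there is $C>0$ with $\big(\frac1{|B|}\int_B V^s\big)^{1/s}\le C\,\frac1{|B|}\int_B V$ for every ball $B$ (with the essential supremum over $B$ on the left if $s=\infty$). Let $$\rho(x)=\sup\Big\{r>0:\ \frac1{r^{d-2}}\int_{B(x,r)}V(y)\,dy\le 1\Big\}$$ be the critical radius function of $V$. Let $B(x_0,r)$ denote the ball with centre $x_0$ and radius $r$, and $Q(x_0,r)$ the cube with centre $x_0$, side length $r$ and sides parallel to the axes; $x_0\in\mathbb R^d$ and $r>0$ are arbitrary. *Weights.* Let $1\le p<\infty$. For a nonnegative locally integrable function $\omega$ write $\omega(S)=\int_S\omega$. For $\theta>0$, $\omega\in A_p^{\rho,\theta}$ means that for some $C>0$ and all balls $B=B(x_0,r)$, $$\Big(\frac1{|B|}\int_B\omega\Big)^{1/p}\Big(\frac1{|B|}\int_B\omega^{-p'/p}\Big)^{1/p'}\le C\Big(1+\frac r{\rho(x_0)}\Big)^\theta,\qquad p'=\frac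 p{p-1},$$ if $p>1$, and $\frac1{|B|}\int_B\omega\le C(1+r/\rho(x_0))^\theta\operatorname{ess\,inf}_B\omega$ if $p=1$. Put $A_p^{\rho,\infty}=\bigcup_{\theta>0}A_p^{\rho,\theta}$. For $\theta\ge0$ let $[\omega]_{A_p^{\rho,\theta}}\in[0,\infty]$ be the supremum over all balls $B=B(x_0,r)$ of $(1+r/\rho(x_0))^{-\theta}$ times the left-hand product above (for $p=1$, times $\frac1{|B|}\int_B\omega\cdot(\operatorname{ess\,inf}_B\omega)^{-1}$). For $\omega\in A_p^{\rho,\infty}$ put $[\omega]_{A_p^{\rho,\infty}}=[\omega]_{A_p^{\rho,\theta^*}}$ with $\theta^*=\inf\{\theta>0:\omega\in A_p^{\rho,\theta}\}$; this may be $+\infty$. *Spaces.* A locally integrable real function $f$ belongs to $\mathrm{BLO}_{\rho,\theta}$ if for some $C>0$ and all cubes $Q=Q(x_0,r)$, $$\frac1{|Q|}\int_Q\big[f-\operatorname{ess\,inf}_Qf\big]\,dx\le C\Big(1+\frac r{\rho(x_0)}\Big)^\theta .$$ It belongs to $\mathcal C^{\beta,*}_{\rho,\theta}$ if for some $C>0$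 and all balls $B=B(x_0,r)$, $$\frac1{|B|^{1+\beta/d}}\int_B\big[f-\operatorname{ess\,inf}_Bf\big]\,dx\le C\Big(1+\frac r{\rho(x_0)}\Big)^\theta .$$ (If $\operatorname{ess\,inf}f=-\infty$ on a cube or ball, the left-hand sides here and below are $+\infty$.) Put $\mathrm{BLO}_{\rho,\infty}=\bigcup_{\theta>0}\mathrm{BLO}_{\rho,\theta}$ and $\mathcal C^{\beta,*}_{\rho,\infty}=\bigcup_{\theta>0}\mathcal C^{\beta,*}_{\rho,\theta}$. **Statement.** Let $1\le p<\infty$, let $\omega\in A_p^{\rho,\infty}$ be not a.e. zero, and let $f\colon\mathbb R^d\to\mathbb R$ be Lebesgue measurable. 1. $f\in\mathrm{BLO}_{\rho,\infty}$ if and only if there are $C>0$ and $N>0$ such that for all cubes $Q=Q(x_0,r)$, $$\Big(\frac1{\omega(Q)}\int_Q\big[f-\operatorname{ess\,inf}_Qf\big]^p\,\omega\,dx\Big)^{1/p}\le C\Big(1+\frac r{\rho(x_0)}\Big)^{N}.$$ 2. For every $0<\beta<1$, $f\in\mathcal C^{\beta,*}_{\rho,\infty}$ if and only if there are $C>0$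 and $N>0$ such that for all balls $B=B(x_0,r)$, $$\frac1{|B|^{\beta/d}}\Big(\frac1{\omega(B)}\int_B\big[f-\operatorname{ess\,inf}_Bf\big]^p\,\omega\,dx\Big)^{1/p}\le C\Big(1+\frac r{\rho(x_0)}\Big)^{N}.$$ Moreover, if $[\omega]_{A_p^{\rho,\infty}}<\infty$, both equivalences also hold with $C\,[\omega]_{A_p^{\rho,\infty}}$ in place of $C$ on the right-hand sides. -/

import Mathlib

open MeasureTheory
open scoped ENNReal

noncomputable section

namespace SchrodingerBLO

/-- The Euclidean space `ℝ^d`. -/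
abbrev E (d : ℕ) : Type := EuclideanSpace ℝ (Fin d)

variable {d : ℕ}

/-- The (open) cube with centre `x₀`, side length `r` and sides parallel to the axes. -/
def cube (x₀ : E d) (r : ℝ) : Set (E d) := {x | ∀ i, |x i - x₀ i| < r / 2}

/-- The average of a `[0, ∞]`-valued function over the set `S`. -/
def avg (S : Set (E d)) (g : E d → ℝ≥0∞) : ℝ≥0∞ := (∫⁻ x in S, g x) / volume S

/-- `V` belongs to the reverse Hölder class `RH_s`, `s ∈ (1, ∞]`: it is nonnegative, locally
integrable, and its normalized `L^s` norm over every ball is at most a constant multiple of its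
average over the ball. For `s = ∞` the left-hand side is the essential supremum over the ball. -/
def ReverseHolder (s : ℝ≥0∞) (V : E d → ℝ) : Prop :=
  (∀ x, 0 ≤ V x) ∧ LocallyIntegrable V ∧
    ∃ C : ℝ, 0 < C ∧ ∀ (x₀ : E d) (r : ℝ), 0 < r →
      eLpNorm V s ((volume (Metric.ball x₀ r))⁻¹ • volume.restrict (Metric.ball x₀ r)) ≤
        ENNReal.ofReal (C * ⨍ y in Metric.ball x₀ r, V y)

/-- The critical radius function of the potential `V` (used for `d ≥ 3`). -/
def criticalRadius (V : E d → ℝ) (x : E d) : ℝ :=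
  sSup {r : ℝ | 0 < r ∧ 1 / r ^ (d - 2) * ∫ y in Metric.ball x r, V y ≤ 1}

/-- A weight: a nonnegative locally integrable function. -/
def IsWeight (ω : E d → ℝ) : Prop := (∀ x, 0 ≤ ω x) ∧ LocallyIntegrable ω

/-- The weighted measure `ω(S) = ∫_S ω`. -/
def weightOf (ω : E d → ℝ) (S : Set (E d)) : ℝ≥0∞ := ∫⁻ x in S, ENNReal.ofReal (ω x)

/-- The product of averages in the Muckenhoupt condition on the set `B`: for `p > 1`,
`(⨍_B ω)^{1/p} (⨍_B ω^{-p'/p})^{1/p'}` with `p' = p / (p - 1)`, and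
`(⨍_B ω) (ess inf_B ω)⁻¹` for `p = 1`. -/
def muckenhouptProduct (p : ℝ) (ω : E d → ℝ) (B : Set (E d)) : ℝ≥0∞ :=
  if p = 1 then
    avg B (fun x => ENNReal.ofReal (ω x)) *
      (essInf (fun x => ENNReal.ofReal (ω x)) (volume.restrict B))⁻¹
  else
    avg B (fun x => ENNReal.ofReal (ω x)) ^ (1 / p) *
      avg B (fun x => ENNReal.ofReal (ω x) ^ (-((p / (p - 1)) / p))) ^ (1 / (p / (p - 1)))

/-- The class `A_p^{ρ,θ}`, `1 ≤ p < ∞`. -/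
def MemA (ρ : E d → ℝ) (θ p : ℝ) (ω : E d → ℝ) : Prop :=
  IsWeight ω ∧ ∃ C : ℝ, 0 < C ∧ ∀ (x₀ : E d) (r : ℝ), 0 < r →
    if p = 1 then
      avg (Metric.ball x₀ r) (fun x => ENNReal.ofReal (ω x)) ≤
        ENNReal.ofReal (C * (1 + r / ρ x₀) ^ θ) *
          essInf (fun x => ENNReal.ofReal (ω x)) (volume.restrict (Metric.ball x₀ r))
    else
      muckenhouptProduct p ω (Metric.ball x₀ r) ≤ ENNReal.ofReal (C * (1 + r / ρ x₀) ^ θ)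

/-- The class `A_p^{ρ,∞}`, the union of the classes `A_p^{ρ,θ}` over `θ > 0`. -/
def MemAInf (ρ : E d → ℝ) (p : ℝ) (ω : E d → ℝ) : Prop := ∃ θ : ℝ, 0 < θ ∧ MemA ρ θ p ω

/-- The characteristic constant `[ω]_{A_p^{ρ,θ}} ∈ [0, ∞]`. -/
def charConst (ρ : E d → ℝ) (θ p : ℝ) (ω : E d → ℝ) : ℝ≥0∞ :=
  ⨆ (x₀ : E d) (r : ℝ) (_ : 0 < r),
    ENNReal.ofReal ((1 + r / ρ x₀) ^ (-θ)) * muckenhouptProduct p ω (Metric.ball x₀ r)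

/-- The characteristic constant `[ω]_{A_p^{ρ,∞}} = [ω]_{A_p^{ρ,θ*}} ∈ [0, ∞]`, where `θ*` is the
infimum of the `θ > 0` with `ω ∈ A_p^{ρ,θ}`. It is infinite when `θ*` is not an admissible
exponent. -/
def charConstInf (ρ : E d → ℝ) (p : ℝ) (ω : E d → ℝ) : ℝ≥0∞ :=
  charConst ρ (sInf {θ : ℝ | 0 < θ ∧ MemA ρ θ p ω}) p ω

/-- The function `f - ess inf_S f`, with values in `[0, ∞]`. The essential infimum is taken in the
extended reals, so the function is identically `∞` if `f` is not essentially bounded below on `S`.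
(Almost everywhere on `S` the difference is nonnegative, so nothing is lost by the truncation.) -/
def lowerOsc (f : E d → ℝ) (S : Set (E d)) (x : E d) : ℝ≥0∞ :=
  ((f x : EReal) - essInf (fun y => (f y : EReal)) (volume.restrict S)).toENNReal

/-- The space `BLO_{ρ,θ}`. -/
def MemBLO (ρ : E d → ℝ) (θ : ℝ) (f : E d → ℝ) : Prop :=
  LocallyIntegrable f ∧ ∃ C : ℝ, 0 < C ∧ ∀ (x₀ : E d) (r : ℝ), 0 < r →
    avg (cube x₀ r) (lowerOsc f (cube x₀ r)) ≤ ENNReal.ofReal (C * (1 + r / ρ x₀) ^ θ)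

/-- The space `BLO_{ρ,∞}`, the union of the spaces `BLO_{ρ,θ}` over `θ > 0`. -/
def MemBLOInf (ρ : E d → ℝ) (f : E d → ℝ) : Prop := ∃ θ : ℝ, 0 < θ ∧ MemBLO ρ θ f

/-- The space `C^{β,*}_{ρ,θ}`. -/
def MemCampanatoStar (ρ : E d → ℝ) (β θ : ℝ) (f : E d → ℝ) : Prop :=
  LocallyIntegrable f ∧ ∃ C : ℝ, 0 < C ∧ ∀ (x₀ : E d) (r : ℝ), 0 < r →
    (∫⁻ x in Metric.ball x₀ r, lowerOsc f (Metric.ball x₀ r) x) /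
        volume (Metric.ball x₀ r) ^ (1 + β / (d : ℝ)) ≤
      ENNReal.ofReal (C * (1 + r / ρ x₀) ^ θ)

/-- The space `C^{β,*}_{ρ,∞}`, the union of the spaces `C^{β,*}_{ρ,θ}` over `θ > 0`. -/
def MemCampanatoStarInf (ρ : E d → ℝ) (β : ℝ) (f : E d → ℝ) : Prop :=
  ∃ θ : ℝ, 0 < θ ∧ MemCampanatoStar ρ β θ f

/-- The weighted average `(ω(S)⁻¹ ∫_S [f - ess inf_S f]^p ω)^{1/p}`. -/
def weightedOsc (p : ℝ) (ω : E d → ℝ) (f : E d → ℝ) (S : Set (E d)) : ℝ≥0∞ :=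
  ((∫⁻ x in S, lowerOsc f S x ^ p * ENNReal.ofReal (ω x)) / weightOf ω S) ^ (1 / p)

end SchrodingerBLO

end

/-! The unweighted and the weighted oscillation over a set are compared in both directions, and
every loss must be polynomial in Ψ = 1 + r/ρ(x₀).

Weighted to unweighted is Hölder's inequality: the Muckenhoupt condition, in the dual form
`MuckenhouptOn`, bounds the plain average of f - ess inf f by its weighted p-th mean, at the cost of
K^{1/p}, where K is polynomial in Ψ. Finiteness of these averages also yields local integrability of
f.

Unweighted to weighted is a John–Nirenberg argument. Fix a cube Q and suppose that the lower
oscillation over all its subcubes is at most M. A Calderón–Zygmund stopping at height 2M selects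
subcubes filling at most half of Q. Outside them f - ess inf_Q f ≤ 2M a.e.; on each of them the
essential infimum has risen by at most 2cM, with c the dyadic doubling constant, so the problem
restarts there. If sets of at most half the volume carry at most τ^p of the weight, the best
constant A in L^p(ω) satisfies A ≤ 4cM + τA, hence A ≤ 4cM/(1-τ) (`DyadicBLO.step`,
`DyadicBLO.setLIntegral_rpow_le`). The Muckenhoupt condition gives 1/(1-τ) linear in its constant
(`MuckenhouptOn.weightOf_le_of_two_mul_le`). Exponential integrability is never needed, and the loss
stays polynomial.

For M and the Muckenhoupt constant to be uniform over the subcubes of Q, 1 + s/ρ(z) must be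
polynomially bounded by Ψ for all centres z in Q and sides s ≤ r. This is the slow variation of ρ
(`ReverseHolder.le_criticalRadius`). It rests on doubling of the mass of V and on decay of
r^{2-d}∫_{B(x,r)}V with a positive exponent as r shrinks. The latter holds already at s = d/2,
because this quantity is comparable to the L^{d/2} norm of V over the ball, whose power d/2 is
additive over disjoint sets.

For C^{β,*} the same inequality is applied with M proportional to |B|^{β/d}: passing to smaller
subcubes only improves this factor. The characteristic constant, when finite, is also nonzero, so it
is absorbed in C. -/

noncomputable section

namespace SchrodingerBLO

/-! ### Dyadic John–Nirenberg inequality for lower oscillation -/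

section JohnNirenberg

variable {α ι : Type*}

/-- The cell of generation `n` containing `x`, for a sequence `π` of partitions. -/
def cellOf (π : ℕ → α → ι) (n : ℕ) (x : α) : Set α := π n ⁻¹' {π n x}

theorem mem_cellOf_self (π : ℕ → α → ι) (n : ℕ) (x : α) : x ∈ cellOf π n x := rfl

theorem cellOf_eq_of_mem {π : ℕ → α → ι} {n : ℕ} {x y : α} (h : y ∈ cellOf π n x) :
    cellOf π n y = cellOf π n x := by
  have : π n y = π n x := h
  simp only [cellOf, this]

theorem cellOf_anti {π : ℕ → α → ι}
    (hnest : ∀ n x y, π (n + 1) x = π (n + 1) y → π n x = π n y) {m n : ℕ} (hmn : m ≤ n) (x : α) :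
    cellOf π n x ⊆ cellOf π m x := by
  induction n, hmn using Nat.le_induction with
  | base => exact subset_rfl
  | succ n _ ih => exact fun y hy => ih (hnest n y x hy)

variable [MeasurableSpace α]

/-- The hypotheses of the dyadic John–Nirenberg inequality: `π` is a nested sequence of countable
partitions, and on every cell inside `Q` the function `f` is bounded below by `b`, with mean
oscillation above this lower bound at most `M`. The measure `ν` charges subsets of `μ`-proportion
at most one half with proportion at most `τ ^ p`. -/
structure DyadicBLO (π : ℕ → α → ι) (μ ν : Measure α) (Q : Set α) (f : α → ℝ) (b : ℕ → ι → ℝ)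
    (M c : ℝ≥0∞) (τ p : ℝ) : Prop where
  meas : ∀ n k, MeasurableSet (π n ⁻¹' {k})
  nest : ∀ n x y, π (n + 1) x = π (n + 1) y → π n x = π n y
  stable : ∀ n, ∀ x ∈ Q, cellOf π n x ⊆ Q
  pos : ∀ n, ∀ x ∈ Q, μ (cellOf π n x) ≠ 0
  fin : ∀ n, ∀ x ∈ Q, μ (cellOf π n x) ≠ ∞
  doubling : ∀ n, ∀ x ∈ Q, μ (cellOf π n x) ≤ c * μ (cellOf π (n + 1) x)
  abs : ν ≪ μ
  aemeas : AEMeasurable f μ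
  lower : ∀ n, ∀ x ∈ Q, ∀ᵐ y ∂μ.restrict (cellOf π n x), b n (π n x) ≤ f y
  osc : ∀ n, ∀ x ∈ Q, ∫⁻ y in cellOf π n x, ENNReal.ofReal (f y - b n (π n x)) ∂μ ≤
    M * μ (cellOf π n x)
  diff : ∀ n, ∀ x ∈ Q, ∀ᵐ y ∂μ.restrict (cellOf π n x), ∀ t : ℝ≥0∞,
    (∀ m, n ≤ m → ∫⁻ z in cellOf π m y, ENNReal.ofReal (f z - b n (π n x)) ∂μ ≤
      t * μ (cellOf π m y)) → ENNReal.ofReal (f y - b n (π n x)) ≤ t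
  -- The p-th power of τ makes the gain in the L^p norm exactly a factor τ.
  half : ∀ n, ∀ x ∈ Q, ∀ S ⊆ cellOf π n x, MeasurableSet S →
    2 * μ S ≤ μ (cellOf π n x) → ν S ≤ ENNReal.ofReal τ ^ p * ν (cellOf π n x)

variable {π : ℕ → α → ι} {μ ν : Measure α} {Q : Set α} {f : α → ℝ} {b : ℕ → ι → ℝ}
    {M c : ℝ≥0∞} {τ p : ℝ}

/-- As f is a.e. at least its lower bound on the small cell, the mean of f minus the root's bound
dominates the difference of the two bounds. This controls the jump of the lower bound from the root
to a stopping cell. -/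
theorem DyadicBLO.lower_sub_le (h : DyadicBLO π μ ν Q f b M c τ p) {n N : ℕ} {x x₀ : α}
    (hx : x ∈ Q) {t : ℝ≥0∞}
    (ht : ∫⁻ y in cellOf π n x, ENNReal.ofReal (f y - b N (π N x₀)) ∂μ ≤ t * μ (cellOf π n x)) :
    ENNReal.ofReal (b n (π n x) - b N (π N x₀)) ≤ t := by
  refine (ENNReal.mul_le_mul_iff_left (h.pos n x hx) (h.fin n x hx)).1 (le_trans ?_ ht)
  rw [← setLIntegral_const]
  refine lintegral_mono_ae ?_
  filter_upwards [h.lower n x hx] with y hy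
  exact ENNReal.ofReal_le_ofReal (by linarith)

/-- On a single cell inside the stopping region, the truncated oscillation is controlled. -/
theorem DyadicBLO.setLIntegral_cell_le (h : DyadicBLO π μ ν Q f b M c τ p) (hp : 1 ≤ p)
    {n N : ℕ} {x x₀ : α} (hx : x ∈ Q) {t A T : ℝ≥0∞}
    (ht : ∫⁻ y in cellOf π n x, ENNReal.ofReal (f y - b N (π N x₀)) ∂μ ≤ t * μ (cellOf π n x))
    (hA : ∫⁻ y in cellOf π n x, (min (ENNReal.ofReal (f y - b n (π n x))) T) ^ p ∂ν ≤
      A ^ p * ν (cellOf π n x)) :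
    ∫⁻ y in cellOf π n x, (min (ENNReal.ofReal (f y - b N (π N x₀))) T) ^ p ∂ν ≤
      (t + A) ^ p * ν (cellOf π n x) := by
  have hp0 : 0 < p := by linarith
  have hb := h.lower_sub_le hx ht
  have hfm : AEMeasurable f (ν.restrict (cellOf π n x)) :=
    (h.aemeas.mono_ac h.abs).restrict
  set S := cellOf π n x
  have h1 : ∀ y, min (ENNReal.ofReal (f y - b N (π N x₀))) T ≤
      t + min (ENNReal.ofReal (f y - b n (π n x))) T := by
    intro y
    rw [← min_add_add_left]
    refine min_le_min ?_ le_add_self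
    calc ENNReal.ofReal (f y - b N (π N x₀))
        = ENNReal.ofReal ((b n (π n x) - b N (π N x₀)) + (f y - b n (π n x))) := by
          congr 1; ring
      _ ≤ _ := ENNReal.ofReal_add_le
      _ ≤ _ := by gcongr
  calc _ ≤ ∫⁻ y in S, (t + min (ENNReal.ofReal (f y - b n (π n x))) T) ^ p ∂ν :=
        lintegral_mono fun y => ENNReal.rpow_le_rpow (h1 y) hp0.le
    _ = ((∫⁻ y in S, (t + min (ENNReal.ofReal (f y - b n (π n x))) T) ^ p ∂ν) ^ (1 / p)) ^ p := by
        rw [← ENNReal.rpow_mul, one_div, inv_mul_cancel₀ hp0.ne', ENNReal.rpow_one]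
    _ ≤ ((∫⁻ _ in S, t ^ p ∂ν) ^ (1 / p) +
          (∫⁻ y in S, (min (ENNReal.ofReal (f y - b n (π n x))) T) ^ p ∂ν) ^ (1 / p)) ^ p := by
        refine ENNReal.rpow_le_rpow ?_ hp0.le
        refine ENNReal.lintegral_Lp_add_le aemeasurable_const ?_ hp
        exact ((hfm.sub_const _).ennreal_ofReal).min aemeasurable_const
    _ ≤ ((t ^ p * ν S) ^ (1 / p) + (A ^ p * ν S) ^ (1 / p)) ^ p := by
        rw [setLIntegral_const]
        gcongr
    _ = _ := by
        have hp' : 0 ≤ 1 / p := by positivity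
        rw [ENNReal.mul_rpow_of_nonneg _ _ hp', ENNReal.mul_rpow_of_nonneg _ _ hp',
          ← ENNReal.rpow_mul, ← ENNReal.rpow_mul, mul_one_div_cancel hp0.ne', ENNReal.rpow_one,
          ENNReal.rpow_one, ← add_mul, ENNReal.mul_rpow_of_nonneg _ _ hp0.le, ← ENNReal.rpow_mul,
          one_div, inv_mul_cancel₀ hp0.ne', ENNReal.rpow_one]

variable [Countable ι]

/-- One step of the self-improving argument: a Calderón–Zygmund decomposition at height `2M`. -/
theorem DyadicBLO.step (h : DyadicBLO π μ ν Q f b M c τ p) (hp : 1 ≤ p)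
    (hM0 : M ≠ 0) (hMt : M ≠ ∞) (hc : 1 ≤ c) (hτ : ENNReal.ofReal τ ≤ 1) {A T : ℝ≥0∞}
    (hA : ∀ n, ∀ x ∈ Q, ∫⁻ y in cellOf π n x, (min (ENNReal.ofReal (f y - b n (π n x))) T) ^ p ∂ν ≤
      A ^ p * ν (cellOf π n x)) (N : ℕ) {x₀ : α} (hx₀ : x₀ ∈ Q) :
    ∫⁻ y in cellOf π N x₀, (min (ENNReal.ofReal (f y - b N (π N x₀))) T) ^ p ∂ν ≤
      (4 * c * M + ENNReal.ofReal τ * A) ^ p * ν (cellOf π N x₀) := by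
  have hp0 : 0 < p := by linarith
  set u : α → ℝ≥0∞ := fun y => ENNReal.ofReal (f y - b N (π N x₀)) with hu
  set R := cellOf π N x₀ with hR
  have hRm : MeasurableSet R := h.meas _ _
  have hRQ : R ⊆ Q := h.stable N x₀ hx₀
  have hRcell : ∀ x ∈ R, cellOf π N x = R := fun x hx => cellOf_eq_of_mem hx
  have hsub : ∀ n, N ≤ n → ∀ x ∈ R, cellOf π n x ⊆ R := fun n hn x hx => by
    rw [← hRcell x hx]; exact cellOf_anti h.nest hn x
  -- The root has mean at most M, so it is not bad at height 2M, and disjoint bad cells fill at most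
  -- half of it.
  let bad : ℕ → α → Prop := fun n x => 2 * M * μ (cellOf π n x) < ∫⁻ y in cellOf π n x, u y ∂μ
  have bad_congr : ∀ {n x y}, y ∈ cellOf π n x → (bad n y ↔ bad n x) := fun {n x y} hy => by
    simp only [bad, cellOf_eq_of_mem hy]
  -- The maximal bad cells: `j.1` is the first bad generation of the points of `P j`. Badness is
  -- constant on cells, so each `P j` is empty or a whole cell.
  let P : ℕ × ι → Set α := fun j => {x | x ∈ R ∧ N ≤ j.1 ∧ π j.1 x = j.2 ∧ bad j.1 x ∧
    ∀ m, N ≤ m → m < j.1 → ¬ bad m x}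
  have hPcell : ∀ j, ∀ x ∈ P j, P j = cellOf π j.1 x := by
    rintro ⟨n, k⟩ x ⟨hxR, hn, hk, hb, hm⟩
    ext y
    constructor
    · rintro ⟨-, -, hk', -⟩
      exact hk'.trans hk.symm
    · intro hy
      refine ⟨hsub n hn x hxR hy, hn, Eq.trans hy hk, (bad_congr hy).2 hb, fun m hNm hmn => ?_⟩
      rw [bad_congr (cellOf_anti h.nest hmn.le x hy)]
      exact hm m hNm hmn
  have hPmeas : ∀ j, MeasurableSet (P j) := by
    intro j
    rcases (P j).eq_empty_or_nonempty with he | ⟨x, hx⟩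
    · rw [he]; exact MeasurableSet.empty
    · rw [hPcell j x hx]; exact h.meas _ _
  have hPdisj : Pairwise (Function.onFun Disjoint P) := by
    intro i j hij
    refine Set.disjoint_left.2 fun x hi hj => hij ?_
    obtain ⟨-, hin, hik, hib, him⟩ := hi
    obtain ⟨-, hjn, hjk, hjb, hjm⟩ := hj
    have : i.1 = j.1 := by
      rcases lt_trichotomy i.1 j.1 with hlt | heq | hlt
      · exact absurd hib (hjm _ hin hlt)
      · exact heq
      · exact absurd hjb (him _ hjn hlt)
    exact Prod.ext this (by rw [← hik, ← hjk, this])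
  set Ω := ⋃ j, P j with hΩ
  have hΩm : MeasurableSet Ω := MeasurableSet.iUnion hPmeas
  have hΩR : Ω ⊆ R := Set.iUnion_subset fun j x hx => hx.1
  have hmem : ∀ x ∈ R, x ∉ Ω → ∀ m, N ≤ m → ¬ bad m x := by
    intro x hxR hx m hm hb
    classical
    have hex : ∃ m, N ≤ m ∧ bad m x := ⟨m, hm, hb⟩
    refine hx (Set.mem_iUnion.2 ⟨(Nat.find hex, π (Nat.find hex) x), hxR, (Nat.find_spec hex).1,
      rfl, (Nat.find_spec hex).2, fun m hNm hlt hbm => Nat.find_min hex hlt ⟨hNm, hbm⟩⟩)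
  have hhalf : 2 * μ Ω ≤ μ R := by
    have h1 : 2 * M * μ Ω ≤ M * μ R := by
      calc 2 * M * μ Ω = ∑' j, 2 * M * μ (P j) := by
            rw [hΩ, measure_iUnion hPdisj hPmeas, ENNReal.tsum_mul_left]
        _ ≤ ∑' j, ∫⁻ y in P j, u y ∂μ := by
            refine ENNReal.tsum_le_tsum fun j => ?_
            rcases (P j).eq_empty_or_nonempty with he | ⟨x, hx⟩
            · simp [he]
            · rw [hPcell j x hx]; exact hx.2.2.2.1.le
        _ = ∫⁻ y in Ω, u y ∂μ := (lintegral_iUnion hPmeas hPdisj _).symm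
        _ ≤ ∫⁻ y in R, u y ∂μ := lintegral_mono_set hΩR
        _ ≤ M * μ R := h.osc N x₀ hx₀
    rw [mul_comm 2 M, mul_assoc] at h1
    exact (ENNReal.mul_le_mul_iff_right hM0 hMt).1 h1
  have hνΩ : ν Ω ≤ ENNReal.ofReal τ ^ p * ν R := h.half N x₀ hx₀ Ω hΩR hΩm hhalf
  have hin : ∫⁻ y in Ω, (min (u y) T) ^ p ∂ν ≤ (2 * c * M + A) ^ p * ν Ω := by
    rw [hΩ, lintegral_iUnion hPmeas hPdisj, measure_iUnion hPdisj hPmeas, ← ENNReal.tsum_mul_left]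
    refine ENNReal.tsum_le_tsum fun j => ?_
    rcases (P j).eq_empty_or_nonempty with he | ⟨x, hx⟩
    · simp [he]
    rw [hPcell j x hx]
    have hxQ : x ∈ Q := hRQ hx.1
    refine h.setLIntegral_cell_le hp hxQ ?_ (hA _ x hxQ)
    obtain ⟨hxR, hn, -, hb, hm⟩ := hx
    -- A stopping cell is never the root, so its parent lies in the tree and is not bad. The
    -- parent's mean 2M and doubling give mean at most 2cM on the stopping cell.
    obtain ⟨m, hjm⟩ : ∃ m, j.1 = m + 1 ∧ N ≤ m := by
      rcases hn.eq_or_lt with heq | hlt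
      · exfalso
        rw [← heq] at hb
        have h2 := h.osc N x₀ hx₀
        simp only [bad, hRcell x hxR] at hb
        refine absurd (hb.trans_le h2) (not_lt.2 ?_)
        rw [two_mul]
        gcongr
        exact le_self_add
      · exact ⟨j.1 - 1, by omega, by omega⟩
    obtain ⟨hj, hNm⟩ := hjm
    have hnb := hm m hNm (by omega)
    simp only [bad, not_lt] at hnb
    rw [hj]
    calc ∫⁻ y in cellOf π (m + 1) x, u y ∂μ ≤ ∫⁻ y in cellOf π m x, u y ∂μ :=
          lintegral_mono_set (cellOf_anti h.nest (Nat.le_succ m) x)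
      _ ≤ 2 * M * μ (cellOf π m x) := hnb
      _ ≤ 2 * M * (c * μ (cellOf π (m + 1) x)) := by gcongr; exact h.doubling m x hxQ
      _ = 2 * c * M * μ (cellOf π (m + 1) x) := by ring
  -- Off the stopping set no cell is bad, so differentiation bounds `u` by 2M almost everywhere.
  have hout : ∫⁻ y in R \ Ω, (min (u y) T) ^ p ∂ν ≤ (2 * c * M) ^ p * ν R := by
    calc ∫⁻ y in R \ Ω, (min (u y) T) ^ p ∂ν ≤ ∫⁻ _ in R \ Ω, (2 * c * M) ^ p ∂ν := by
          refine setLIntegral_mono_ae' (hRm.diff hΩm) ?_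
          have h3 := (ae_restrict_iff' hRm).1 (h.diff N x₀ hx₀)
          filter_upwards [h.abs.ae_le h3] with y hy hyR
          refine ENNReal.rpow_le_rpow ((min_le_left _ _).trans ?_) hp0.le
          refine (hy hyR.1 (2 * M) fun m hm => not_lt.1 (hmem y hyR.1 hyR.2 m hm)).trans ?_
          calc 2 * M = 2 * 1 * M := by ring
            _ ≤ 2 * c * M := by gcongr
      _ = (2 * c * M) ^ p * ν (R \ Ω) := setLIntegral_const _ _
      _ ≤ _ := by gcongr; exact Set.sdiff_subset
  calc ∫⁻ y in R, (min (u y) T) ^ p ∂ν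
      = ∫⁻ y in Ω, (min (u y) T) ^ p ∂ν + ∫⁻ y in R \ Ω, (min (u y) T) ^ p ∂ν := by
        rw [← lintegral_inter_add_sdiff _ R hΩm, Set.inter_eq_self_of_subset_right hΩR]
    _ ≤ (2 * c * M + A) ^ p * (ENNReal.ofReal τ ^ p * ν R) + (2 * c * M) ^ p * ν R := by
        refine add_le_add (hin.trans ?_) hout
        gcongr
    _ = ((ENNReal.ofReal τ * (2 * c * M + A)) ^ p + (2 * c * M) ^ p) * ν R := by
        rw [ENNReal.mul_rpow_of_nonneg (ENNReal.ofReal τ) _ hp0.le]; ring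
    -- Superadditivity of t ↦ t^p for p ≥ 1 merges the two contributions.
    _ ≤ (ENNReal.ofReal τ * (2 * c * M + A) + 2 * c * M) ^ p * ν R := by
        gcongr
        exact ENNReal.add_rpow_le_rpow_add _ _ hp
    _ ≤ (4 * c * M + ENNReal.ofReal τ * A) ^ p * ν R := by
        have h4 : ENNReal.ofReal τ * (2 * c * M + A) + 2 * c * M ≤
            4 * c * M + ENNReal.ofReal τ * A :=
          calc ENNReal.ofReal τ * (2 * c * M + A) + 2 * c * M
              = ENNReal.ofReal τ * (2 * c * M) + ENNReal.ofReal τ * A + 2 * c * M := by ring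
            _ ≤ 1 * (2 * c * M) + ENNReal.ofReal τ * A + 2 * c * M := by gcongr
            _ = 4 * c * M + ENNReal.ofReal τ * A := by ring
        gcongr

/-- Dyadic John–Nirenberg inequality for functions of bounded lower oscillation, with respect to a
measure `ν` of Muckenhoupt type. -/
theorem DyadicBLO.setLIntegral_rpow_le (h : DyadicBLO π μ ν Q f b M c τ p) (hp : 1 ≤ p)
    (hM0 : M ≠ 0) (hMt : M ≠ ∞) (hc : 1 ≤ c) (hct : c ≠ ∞) (hτ0 : 0 ≤ τ) (hτ1 : τ < 1)
    (N : ℕ) {x₀ : α} (hx₀ : x₀ ∈ Q) (hν : ν (cellOf π N x₀) ≠ ∞) :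
    ∫⁻ y in cellOf π N x₀, (ENNReal.ofReal (f y - b N (π N x₀))) ^ p ∂ν ≤
      (4 * c * M * ENNReal.ofReal (1 - τ)⁻¹) ^ p * ν (cellOf π N x₀) := by
  have hp0 : 0 < p := by linarith
  have h1τ : 0 < 1 - τ := by linarith
  set B : ℝ≥0∞ := 4 * c * M * ENNReal.ofReal (1 - τ)⁻¹ with hB
  -- `B` is the fixed point of A ↦ 4cM + τA, so j iterations started at T leave B + τ^j T. The
  -- truncation at T provides the finite start; T is removed afterwards by monotone convergence.
  have hfix : 4 * c * M + ENNReal.ofReal τ * B = B := by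
    have : (1 : ℝ≥0∞) + ENNReal.ofReal τ * ENNReal.ofReal (1 - τ)⁻¹ = ENNReal.ofReal (1 - τ)⁻¹ := by
      rw [← ENNReal.ofReal_mul hτ0, ← ENNReal.ofReal_one, ← ENNReal.ofReal_add zero_le_one
        (by positivity)]
      congr 1
      field_simp
      ring
    calc 4 * c * M + ENNReal.ofReal τ * B
        = 4 * c * M * (1 + ENNReal.ofReal τ * ENNReal.ofReal (1 - τ)⁻¹) := by rw [hB]; ring
      _ = B := by rw [this]
  have key : ∀ (T : ℝ≥0∞) (j : ℕ), ∀ n, ∀ x ∈ Q,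
      ∫⁻ y in cellOf π n x, (min (ENNReal.ofReal (f y - b n (π n x))) T) ^ p ∂ν ≤
        (B + ENNReal.ofReal τ ^ j * T) ^ p * ν (cellOf π n x) := by
    intro T j
    induction j with
    | zero =>
      intro n x hx
      rw [← setLIntegral_const]
      refine lintegral_mono fun y => ENNReal.rpow_le_rpow ((min_le_right _ _).trans ?_) hp0.le
      rw [pow_zero, one_mul]
      exact le_add_self
    | succ j ih =>
      intro n x hx
      refine (h.step hp hM0 hMt hc (by simpa using hτ1.le) ih n hx).trans (le_of_eq ?_)
      congr 2
      rw [mul_add, ← add_assoc, hfix, pow_succ]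
      ring
  have hBt : B ≠ ∞ := by
    simp only [hB]
    exact ENNReal.mul_ne_top (ENNReal.mul_ne_top (ENNReal.mul_ne_top (by simp) hct) hMt)
      ENNReal.ofReal_ne_top
  have key2 : ∀ T : ℝ≥0∞, T ≠ ∞ →
      ∫⁻ y in cellOf π N x₀, (min (ENNReal.ofReal (f y - b N (π N x₀))) T) ^ p ∂ν ≤
        B ^ p * ν (cellOf π N x₀) := by
    intro T hT
    refine ge_of_tendsto' (x := Filter.atTop) ?_ fun j => key T j N x₀ hx₀
    have h1 : Filter.Tendsto (fun j : ℕ => B + ENNReal.ofReal τ ^ j * T) Filter.atTop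
        (nhds (B + 0 * T)) := by
      refine Filter.Tendsto.add tendsto_const_nhds (ENNReal.Tendsto.mul_const ?_ (Or.inr hT))
      exact ENNReal.tendsto_pow_atTop_nhds_zero_of_lt_one (by simpa using hτ1)
    rw [zero_mul, add_zero] at h1
    exact ENNReal.Tendsto.mul_const ((ENNReal.continuous_rpow_const.tendsto _).comp h1) (Or.inr hν)
  have hfm : AEMeasurable f (ν.restrict (cellOf π N x₀)) :=
    (h.aemeas.mono_ac h.abs).restrict
  have hsup : ∀ y, (ENNReal.ofReal (f y - b N (π N x₀))) ^ p =
      ⨆ T : ℕ, (min (ENNReal.ofReal (f y - b N (π N x₀))) (T : ℝ≥0∞)) ^ p := by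
    intro y
    refine le_antisymm ?_ (iSup_le fun T => ENNReal.rpow_le_rpow (min_le_left _ _) hp0.le)
    obtain ⟨T, hT⟩ := exists_nat_ge (f y - b N (π N x₀))
    refine le_iSup_of_le T (le_of_eq ?_)
    rw [min_eq_left]
    rw [← ENNReal.ofReal_natCast]
    exact ENNReal.ofReal_le_ofReal hT
  simp_rw [hsup]
  rw [lintegral_iSup']
  · exact iSup_le fun T => key2 T (ENNReal.natCast_ne_top T)
  · intro T
    exact (((hfm.sub_const _).ennreal_ofReal).min aemeasurable_const).pow_const _
  · refine Filter.Eventually.of_forall fun y i j hij => ?_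
    exact ENNReal.rpow_le_rpow (min_le_min le_rfl (by exact_mod_cast hij)) hp0.le

end JohnNirenberg

/-! ### Power laws from dyadic iteration -/

section Growth

/-- Iterate over the n doublings with 2^n ≤ R/r < 2^(n+1); the factor 2^a pays for rounding R/r to a
power of two. -/
theorem le_rpow_mul_of_le_two_mul {w : ℝ → ℝ} (hmono : ∀ r R, 0 < r → r ≤ R → w r ≤ w R)
    (hnn : ∀ r, 0 < r → 0 ≤ w r) {a : ℝ} (ha : 0 ≤ a)
    (h : ∀ r, 0 < r → w r ≤ 2 ^ (-a) * w (2 * r)) {r R : ℝ} (hr : 0 < r) (hrR : r ≤ R) :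
    w r ≤ 2 ^ a * (r / R) ^ a * w R := by
  have hR : 0 < R := hr.trans_le hrR
  obtain ⟨n, hn1, hn2⟩ := exists_nat_pow_near ((one_le_div hr).2 hrR) (one_lt_two (α := ℝ))
  have iter : ∀ n : ℕ, w r ≤ (2 ^ (-a)) ^ n * w (2 ^ n * r) := by
    intro n
    induction n with
    | zero => simp
    | succ n ih =>
      refine ih.trans ?_
      rw [pow_succ, mul_assoc]
      refine mul_le_mul_of_nonneg_left ?_ (by positivity)
      refine (h (2 ^ n * r) (by positivity)).trans (le_of_eq ?_)
      ring_nf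
  have h1 : w (2 ^ n * r) ≤ w R := hmono _ _ (by positivity) ((le_div_iff₀ hr).1 hn1)
  refine (iter n).trans ((mul_le_mul_of_nonneg_left h1 (by positivity)).trans ?_)
  refine mul_le_mul_of_nonneg_right ?_ (hnn R hR)
  have h2 : r / R = (R / r)⁻¹ := by rw [inv_div]
  rw [h2, Real.inv_rpow (by positivity), ← div_eq_mul_inv, le_div_iff₀ (by positivity)]
  calc (2 ^ (-a)) ^ n * (R / r) ^ a ≤ (2 ^ (-a)) ^ n * ((2 : ℝ) ^ (n + 1)) ^ a := by
        gcongr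
    _ = 2 ^ a := by
        rw [← Real.rpow_natCast, ← Real.rpow_natCast, ← Real.rpow_mul (by norm_num),
          ← Real.rpow_mul (by norm_num), ← Real.rpow_add (by norm_num)]
        congr 1
        push_cast
        ring

theorem le_rpow_mul_of_two_mul_le {v : ℝ → ℝ} (hmono : ∀ r R, 0 < r → r ≤ R → v r ≤ v R)
    (hnn : ∀ r, 0 < r → 0 ≤ v r) {b : ℝ} (hb : 0 ≤ b)
    (h : ∀ r, 0 < r → v (2 * r) ≤ 2 ^ b * v r) {r R : ℝ} (hr : 0 < r) (hrR : r ≤ R) :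
    v R ≤ 2 ^ b * (R / r) ^ b * v r := by
  have hR : 0 < R := hr.trans_le hrR
  obtain ⟨n, hn1, hn2⟩ := exists_nat_pow_near ((one_le_div hr).2 hrR) (one_lt_two (α := ℝ))
  have iter : ∀ n : ℕ, v (2 ^ n * r) ≤ (2 ^ b) ^ n * v r := by
    intro n
    induction n with
    | zero => simp
    | succ n ih =>
      calc v (2 ^ (n + 1) * r) = v (2 * (2 ^ n * r)) := by ring_nf
        _ ≤ 2 ^ b * v (2 ^ n * r) := h _ (by positivity)
        _ ≤ 2 ^ b * ((2 ^ b) ^ n * v r) := by gcongr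
        _ = _ := by ring
  refine (hmono R (2 ^ (n + 1) * r) hR ((div_le_iff₀ hr).1 hn2.le)).trans ((iter (n + 1)).trans ?_)
  refine mul_le_mul_of_nonneg_right ?_ (hnn r hr)
  calc ((2 : ℝ) ^ b) ^ (n + 1) = 2 ^ b * ((2 : ℝ) ^ n) ^ b := by
        rw [pow_succ, mul_comm]
        congr 1
        rw [← Real.rpow_natCast, ← Real.rpow_natCast, ← Real.rpow_mul (by norm_num),
          ← Real.rpow_mul (by norm_num), mul_comm]
    _ ≤ _ := by gcongr

end Growth

/-! ### Reverse Hölder potentials: doubling and decay of the mass -/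

variable {d : ℕ}

theorem setLIntegral_le_measure_rpow_mul {α : Type*} [MeasurableSpace α] {μ : Measure α} {S : Set α}
    {g : α → ℝ≥0∞} (hg : AEMeasurable g (μ.restrict S)) {q : ℝ} (hq : 1 < q) :
    ∫⁻ x in S, g x ∂μ ≤ μ S ^ (1 - 1 / q) * (∫⁻ x in S, g x ^ q ∂μ) ^ (1 / q) := by
  have hc : q.HolderConjugate (q / (q - 1)) := Real.HolderConjugate.conjExponent hq
  have h := ENNReal.lintegral_mul_le_Lp_mul_Lq (μ.restrict S) hc hg
    (aemeasurable_const (b := (1 : ℝ≥0∞)))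
  simp only [Pi.mul_apply, mul_one, ENNReal.one_rpow, lintegral_const, one_mul,
    Measure.restrict_apply_univ] at h
  rw [mul_comm]
  convert h using 3
  rw [one_div (q / (q - 1)), inv_div, sub_div, div_self (by linarith)]

/-- The reverse Hölder inequality with exponent `d / 2` in unnormalized form. -/
theorem ReverseHolder.exists_le (hd : 3 ≤ d) {s : ℝ≥0∞} (hs : (d : ℝ≥0∞) / 2 ≤ s) {V : E d → ℝ}
    (hV : ReverseHolder s V) :
    ∃ C : ℝ, 0 < C ∧ ∀ (x : E d) (r : ℝ), 0 < r →
      (∫⁻ y in Metric.ball x r, ENNReal.ofReal (V y) ^ ((d : ℝ) / 2)) ^ (1 / ((d : ℝ) / 2)) ≤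
        ENNReal.ofReal C * volume (Metric.ball x r) ^ (1 / ((d : ℝ) / 2) - 1) *
          ∫⁻ y in Metric.ball x r, ENNReal.ofReal (V y) := by
  obtain ⟨hV0, hVl, C, hC, h⟩ := hV
  refine ⟨C, hC, fun x r hr => ?_⟩
  have hd0 : (0 : ℝ) < d := by positivity
  set q : ℝ := (d : ℝ) / 2 with hq
  have hq0 : 0 < q := by positivity
  set B := Metric.ball x r with hB
  have hB0 : volume B ≠ 0 := (Metric.measure_ball_pos volume x hr).ne'
  have hBt : volume B ≠ ∞ := measure_ball_lt_top.ne
  have hint : IntegrableOn V B :=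
    (hVl.integrableOn_isCompact (isCompact_closedBall x r)).mono_set Metric.ball_subset_closedBall
  have hprob : IsProbabilityMeasure ((volume B)⁻¹ • volume.restrict B) :=
    ⟨by simp [ENNReal.inv_mul_cancel hB0 hBt]⟩
  -- With respect to a probability measure the L^s norm increases with s, so every s ≥ d/2,
  -- including ∞, reduces to d/2.
  have h1 := (eLpNorm_le_eLpNorm_of_exponent_le hs
    (hVl.aestronglyMeasurable.restrict.smul_measure _)).trans (h x r hr)
  have hqE : ((d : ℝ≥0∞) / 2) = ENNReal.ofReal q := by
    rw [hq, ENNReal.ofReal_div_of_pos (by norm_num)]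
    simp
  have hVe : ∀ y, ‖V y‖ₑ = ENNReal.ofReal (V y) := fun y => Real.enorm_of_nonneg (hV0 y)
  rw [hqE, eLpNorm_eq_lintegral_rpow_enorm_toReal (by simpa using hq0) ENNReal.ofReal_ne_top,
    ENNReal.toReal_ofReal hq0.le, lintegral_smul_measure] at h1
  simp only [hVe, smul_eq_mul] at h1
  rw [ENNReal.mul_rpow_of_nonneg _ _ (by positivity), ENNReal.ofReal_mul hC.le, setAverage_eq,
    smul_eq_mul, ENNReal.ofReal_mul (by positivity), ofReal_integral_eq_lintegral_ofReal hint
    (Filter.Eventually.of_forall hV0), Measure.real, ENNReal.ofReal_inv_of_pos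
    (ENNReal.toReal_pos hB0 hBt), ENNReal.ofReal_toReal hBt] at h1
  have h2 : ∀ X : ℝ≥0∞, X = volume B ^ (1 / q) * ((volume B)⁻¹ ^ (1 / q) * X) := by
    intro X
    rw [← mul_assoc, ← ENNReal.mul_rpow_of_nonneg _ _ (by positivity : 0 ≤ 1 / q),
      ENNReal.mul_inv_cancel hB0 hBt, ENNReal.one_rpow, one_mul]
  rw [h2 ((∫⁻ y in B, _) ^ (1 / q))]
  refine (mul_le_mul_right h1 _).trans (le_of_eq ?_)
  rw [ENNReal.rpow_sub _ _ hB0 hBt, ENNReal.rpow_one, div_eq_mul_inv (volume B ^ (1 / q))]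
  ring

theorem volume_ball_eq (x : E d) {r : ℝ} (hr : 0 < r) :
    volume (Metric.ball x r) = ENNReal.ofReal (r ^ d) * volume (Metric.ball (0 : E d) 1) := by
  have := Measure.addHaar_ball_of_pos (volume : Measure (E d)) x hr
  simpa using this

/-- 1 - t^d is the proportion of a ball lying outside the concentric ball shrunk by t; it tends to 0
as t → 1. -/
theorem exists_thin_shell_const (d : ℕ) {C e : ℝ} (he : 0 < e) :
    ∃ t : ℝ, 0 < t ∧ t < 1 ∧ C * (1 - t ^ d) ^ e ≤ 1 / 2 := by
  have hcont : Filter.Tendsto (fun t : ℝ => C * (1 - t ^ d) ^ e) (nhdsWithin 1 (Set.Iio 1))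
      (nhds (C * (1 - 1 ^ d) ^ e)) := by
    refine Filter.Tendsto.mono_left ?_ nhdsWithin_le_nhds
    refine ((((continuous_const.sub (continuous_pow d)).tendsto 1).rpow_const
      (Or.inr he.le))).const_mul C
  have h0 : C * (1 - 1 ^ d) ^ e = 0 := by simp [Real.zero_rpow he.ne']
  rw [h0] at hcont
  have h1 := hcont.eventually (Iic_mem_nhds (by norm_num : (0 : ℝ) < 1 / 2))
  have h2 : ∀ᶠ t in nhdsWithin (1 : ℝ) (Set.Iio 1), t ∈ Set.Ioo (0 : ℝ) 1 :=
    Ioo_mem_nhdsLT (by norm_num)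
  obtain ⟨t, ht1, ht2⟩ := (h1.and h2).exists
  exact ⟨t, ht2.1, ht2.2, ht1⟩

/-- The mass of a ball with respect to `V`. -/
def ballMass (V : E d → ℝ) (x : E d) (r : ℝ) : ℝ := ∫ y in Metric.ball x r, V y

theorem ofReal_ballMass {V : E d → ℝ} (hV0 : ∀ x, 0 ≤ V x) (hVl : LocallyIntegrable V) (x : E d)
    (r : ℝ) : ENNReal.ofReal (ballMass V x r) = ∫⁻ y in Metric.ball x r, ENNReal.ofReal (V y) :=
  ofReal_integral_eq_lintegral_ofReal
    ((hVl.integrableOn_isCompact (isCompact_closedBall x r)).mono_set Metric.ball_subset_closedBall)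
    (Filter.Eventually.of_forall hV0)

theorem ballMass_nonneg {V : E d → ℝ} (hV0 : ∀ x, 0 ≤ V x) (x : E d) (r : ℝ) :
    0 ≤ ballMass V x r := integral_nonneg hV0

theorem ballMass_mono {V : E d → ℝ} (hV0 : ∀ x, 0 ≤ V x) (hVl : LocallyIntegrable V) {x y : E d}
    {r R : ℝ} (h : Metric.ball x r ⊆ Metric.ball y R) : ballMass V x r ≤ ballMass V y R := by
  rw [← ENNReal.ofReal_le_ofReal_iff (ballMass_nonneg hV0 y R), ofReal_ballMass hV0 hVl,
    ofReal_ballMass hV0 hVl]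
  exact lintegral_mono_set h

/-- Hölder and reverse Hölder prevent `V` from concentrating on thin shells: for t close to 1, the
shell between radii tr and r carries at most half the mass of the ball. Shrinking by t thus costs a
factor 2, and n shrinkings with t^n < 1/2 give doubling with b = n. -/
theorem ReverseHolder.ballMass_two_mul_le (hd : 3 ≤ d) {s : ℝ≥0∞} (hs : (d : ℝ≥0∞) / 2 ≤ s)
    {V : E d → ℝ} (hV : ReverseHolder s V) :
    ∃ b : ℝ, 0 ≤ b ∧ ∀ (x : E d) (r : ℝ), 0 < r →
      ballMass V x (2 * r) ≤ 2 ^ b * ballMass V x r := by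
  obtain ⟨C, hC, hRH⟩ := hV.exists_le hd hs
  obtain ⟨hV0, hVl, -⟩ := hV
  have hd3 : (3 : ℝ) ≤ d := by exact_mod_cast hd
  set q : ℝ := (d : ℝ) / 2 with hq
  have hq1 : 1 < q := by rw [hq]; linarith
  have he : 0 < 1 - 1 / q := by
    rw [sub_pos, div_lt_one (by linarith)]; exact hq1
  obtain ⟨t, ht0, ht1, ht⟩ := exists_thin_shell_const d (C := C) he
  have hVm : AEMeasurable (fun y => ENNReal.ofReal (V y)) (volume : Measure (E d)) :=
    hVl.aestronglyMeasurable.aemeasurable.ennreal_ofReal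
  have hshell : ∀ (x : E d) (r : ℝ), 0 < r → ballMass V x r ≤ 2 * ballMass V x (t * r) := by
    intro x r hr
    set B := Metric.ball x r
    set B' := Metric.ball x (t * r)
    have hB'B : B' ⊆ B := Metric.ball_subset_ball (by nlinarith)
    have hB0 : volume B ≠ 0 := (Metric.measure_ball_pos volume x hr).ne'
    have hBt : volume B ≠ ∞ := measure_ball_lt_top.ne
    have hvol : volume (B \ B') = ENNReal.ofReal (1 - t ^ d) * volume B := by
      rw [measure_sdiff hB'B measurableSet_ball.nullMeasurableSet measure_ball_lt_top.ne,
        volume_ball_eq x hr, volume_ball_eq x (mul_pos ht0 hr), mul_pow, ENNReal.ofReal_mul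
        (by positivity), ENNReal.ofReal_sub _ (by positivity), ENNReal.ofReal_one,
        ENNReal.sub_mul, one_mul, mul_assoc]
      intros
      exact ENNReal.mul_ne_top ENNReal.ofReal_ne_top measure_ball_lt_top.ne
    have h1 : ∫⁻ y in B \ B', ENNReal.ofReal (V y) ≤
        ENNReal.ofReal (1 / 2) * ∫⁻ y in B, ENNReal.ofReal (V y) := by
      calc _ ≤ volume (B \ B') ^ (1 - 1 / q) *
            (∫⁻ y in B \ B', ENNReal.ofReal (V y) ^ q) ^ (1 / q) :=
            setLIntegral_le_measure_rpow_mul hVm.restrict hq1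
        _ ≤ volume (B \ B') ^ (1 - 1 / q) * (∫⁻ y in B, ENNReal.ofReal (V y) ^ q) ^ (1 / q) := by
            gcongr
            exact Set.sdiff_subset
        _ ≤ volume (B \ B') ^ (1 - 1 / q) * (ENNReal.ofReal C * volume B ^ (1 / q - 1) *
            ∫⁻ y in B, ENNReal.ofReal (V y)) := by
            gcongr
            exact hRH x r hr
        _ = (ENNReal.ofReal C * ENNReal.ofReal (1 - t ^ d) ^ (1 - 1 / q)) *
            ((volume B) ^ (1 - 1 / q) * volume B ^ (1 / q - 1)) *
              ∫⁻ y in B, ENNReal.ofReal (V y) := by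
            rw [hvol, ENNReal.mul_rpow_of_nonneg _ _ he.le]; ring
        _ = ENNReal.ofReal (C * (1 - t ^ d) ^ (1 - 1 / q)) *
              ∫⁻ y in B, ENNReal.ofReal (V y) := by
            rw [← ENNReal.rpow_add _ _ hB0 hBt, ENNReal.ofReal_rpow_of_nonneg
              (sub_nonneg.2 (pow_le_one₀ ht0.le ht1.le)) he.le, ← ENNReal.ofReal_mul hC.le]
            simp
        _ ≤ _ := by gcongr
    have h2 : ENNReal.ofReal (ballMass V x r) ≤
        ENNReal.ofReal (ballMass V x (t * r) + 1 / 2 * ballMass V x r) := by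
      rw [ENNReal.ofReal_add (ballMass_nonneg hV0 _ _)
        (mul_nonneg (by norm_num) (ballMass_nonneg hV0 _ _)), ENNReal.ofReal_mul (by norm_num),
        ofReal_ballMass hV0 hVl, ofReal_ballMass hV0 hVl]
      refine le_trans (le_of_eq ?_) (add_le_add le_rfl h1)
      rw [← lintegral_inter_add_sdiff _ B (measurableSet_ball : MeasurableSet B'),
        Set.inter_eq_self_of_subset_right hB'B]
    rw [ENNReal.ofReal_le_ofReal_iff (add_nonneg (ballMass_nonneg hV0 _ _)
        (mul_nonneg (by norm_num) (ballMass_nonneg hV0 _ _)))] at h2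
    linarith
  obtain ⟨n, hn⟩ := exists_pow_lt_of_lt_one (by norm_num : (0 : ℝ) < 1 / 2) ht1
  refine ⟨n, by positivity, fun x r hr => ?_⟩
  have iter : ∀ m : ℕ, ballMass V x (2 * r) ≤ 2 ^ m * ballMass V x (t ^ m * (2 * r)) := by
    intro m
    induction m with
    | zero => simp
    | succ m ih =>
      refine ih.trans ?_
      rw [pow_succ, mul_assoc]
      refine mul_le_mul_of_nonneg_left ?_ (by positivity)
      refine (hshell x _ (by positivity)).trans (le_of_eq ?_)
      ring_nf
  rw [Real.rpow_natCast]
  refine (iter n).trans (mul_le_mul_of_nonneg_left ?_ (by positivity))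
  refine ballMass_mono hV0 hVl (Metric.ball_subset_ball ?_)
  nlinarith

/-- The `L^{d/2}` norm of `V` over a ball. -/
def ballNorm (V : E d → ℝ) (x : E d) (r : ℝ) : ℝ :=
  (∫⁻ y in Metric.ball x r, ENNReal.ofReal (V y) ^ ((d : ℝ) / 2)).toReal ^ (1 / ((d : ℝ) / 2))

theorem ballNorm_nonneg (V : E d → ℝ) (x : E d) (r : ℝ) : 0 ≤ ballNorm V x r := by
  unfold ballNorm; positivity

theorem ReverseHolder.lintegral_rpow_ne_top (hd : 3 ≤ d) {s : ℝ≥0∞} (hs : (d : ℝ≥0∞) / 2 ≤ s)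
    {V : E d → ℝ} (hV : ReverseHolder s V) (x : E d) {r : ℝ} (hr : 0 < r) :
    ∫⁻ y in Metric.ball x r, ENNReal.ofReal (V y) ^ ((d : ℝ) / 2) ≠ ∞ := by
  obtain ⟨C, hC, hRH⟩ := hV.exists_le hd hs
  have h := hRH x r hr
  have hd0 : (0 : ℝ) < d := by positivity
  intro htop
  rw [htop, ENNReal.top_rpow_of_pos (by positivity), top_le_iff, ← ofReal_ballMass hV.1 hV.2.1] at h
  refine ENNReal.mul_ne_top (ENNReal.mul_ne_top ENNReal.ofReal_ne_top ?_) ENNReal.ofReal_ne_top h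
  exact ENNReal.rpow_ne_top_of_ne_zero (Metric.measure_ball_pos volume x hr).ne'
    measure_ball_lt_top.ne

/-- The mass of a ball and the `L^{d/2}` norm over it are comparable after scaling. -/
theorem ReverseHolder.ballNorm_comparable (hd : 3 ≤ d) {s : ℝ≥0∞} (hs : (d : ℝ≥0∞) / 2 ≤ s)
    {V : E d → ℝ} (hV : ReverseHolder s V) :
    ∃ k C : ℝ, 0 < k ∧ 0 < C ∧ ∀ (x : E d) (r : ℝ), 0 < r →
      ballMass V x r ≤ k * r ^ (d - 2) * ballNorm V x r ∧
      k * r ^ (d - 2) * ballNorm V x r ≤ C * ballMass V x r := by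
  obtain ⟨C, hC, hRH⟩ := hV.exists_le hd hs
  have hfin := fun x r => hV.lintegral_rpow_ne_top hd hs x (r := r)
  obtain ⟨hV0, hVl, -⟩ := hV
  have hd3 : (3 : ℝ) ≤ d := by exact_mod_cast hd
  set q : ℝ := (d : ℝ) / 2 with hq
  have hq1 : 1 < q := by rw [hq]; linarith
  set m : ℝ := (volume (Metric.ball (0 : E d) 1)).toReal with hm
  have hm0 : 0 < m := ENNReal.toReal_pos (Metric.measure_ball_pos volume _ one_pos).ne'
    measure_ball_lt_top.ne
  have hvol : ∀ (x : E d) (r : ℝ), 0 < r → volume (Metric.ball x r) = ENNReal.ofReal (r ^ d * m) :=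
    fun x r hr => by
      rw [volume_ball_eq x hr, ENNReal.ofReal_mul (by positivity),
        ENNReal.ofReal_toReal measure_ball_lt_top.ne]
  have hscale : ∀ r : ℝ, 0 < r → (r ^ d * m) ^ (1 - 1 / q) = m ^ (1 - 1 / q) * r ^ (d - 2) := by
    intro r hr
    rw [Real.mul_rpow (by positivity) hm0.le, mul_comm, ← Real.rpow_natCast, ← Real.rpow_natCast,
      ← Real.rpow_mul hr.le]
    congr 2
    rw [Nat.cast_sub (by omega), hq]
    field_simp
    push_cast
    ring
  have hVm : AEMeasurable (fun y => ENNReal.ofReal (V y)) (volume : Measure (E d)) :=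
    hVl.aestronglyMeasurable.aemeasurable.ennreal_ofReal
  refine ⟨m ^ (1 - 1 / q), C, by positivity, hC, fun x r hr => ?_⟩
  have hpos : 0 < r ^ d * m := by positivity
  have hW : ENNReal.ofReal (ballNorm V x r) =
      (∫⁻ y in Metric.ball x r, ENNReal.ofReal (V y) ^ q) ^ (1 / q) := by
    rw [ballNorm, ← ENNReal.ofReal_rpow_of_nonneg ENNReal.toReal_nonneg (by positivity),
      ENNReal.ofReal_toReal (hfin x r hr)]
  rw [← hscale r hr]
  have hp1 : 0 < (r ^ d * m) ^ (1 - 1 / q) := by positivity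
  constructor
  · rw [← ENNReal.ofReal_le_ofReal_iff (mul_nonneg hp1.le (ballNorm_nonneg V x r)),
      ofReal_ballMass hV0 hVl, ENNReal.ofReal_mul hp1.le, hW, ← ENNReal.ofReal_rpow_of_pos hpos,
      ← hvol x r hr]
    exact setLIntegral_le_measure_rpow_mul hVm.restrict hq1
  · have h := hRH x r hr
    rw [← hW, hvol x r hr, ← ofReal_ballMass hV0 hVl, ENNReal.ofReal_rpow_of_pos hpos,
      ← ENNReal.ofReal_mul hC.le, ← ENNReal.ofReal_mul (by positivity),
      ENNReal.ofReal_le_ofReal_iff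
        (mul_nonneg (by positivity) (ballMass_nonneg hV0 x r))] at h
    refine (mul_le_mul_of_nonneg_left h hp1.le).trans (le_of_eq ?_)
    have : (r ^ d * m) ^ (1 - 1 / q) * (r ^ d * m) ^ (1 / q - 1) = 1 := by
      rw [← Real.rpow_add hpos]; simp
    linear_combination (C * ballMass V x r) * this

theorem exists_dist_eq_of_three_le (hd : 3 ≤ d) (x : E d) (t : ℝ) (ht : 0 ≤ t) :
    ∃ y : E d, dist y x = t := by
  have : Nontrivial (E d) := by
    have : Nonempty (Fin d) := ⟨⟨0, by omega⟩⟩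
    infer_instance
  obtain ⟨z, hz⟩ := exists_norm_eq (E d) ht
  exact ⟨x + z, by simp [hz]⟩

/-- The power d/2 of the norm is additive over disjoint sets. Inside B(x,2r), disjoint from B(x,r),
lies a ball B(y,r/2) with |x - y| = 3r/2, and doubling together with `ballNorm_comparable` shows
that it carries a fixed proportion of the total. Removing it leaves a factor smaller than 1. -/
theorem ReverseHolder.ballNorm_rpow_two_mul (hd : 3 ≤ d) {s : ℝ≥0∞} (hs : (d : ℝ≥0∞) / 2 ≤ s)
    {V : E d → ℝ} (hV : ReverseHolder s V) :
    ∃ a : ℝ, 0 < a ∧ ∀ (x : E d) (r : ℝ), 0 < r →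
      ballNorm V x r ^ ((d : ℝ) / 2) ≤ 2 ^ (-a) * ballNorm V x (2 * r) ^ ((d : ℝ) / 2) := by
  obtain ⟨k, C, hk, hC, hcomp⟩ := hV.ballNorm_comparable hd hs
  obtain ⟨b, hb, hdoub⟩ := hV.ballMass_two_mul_le hd hs
  have hfin := fun x r => hV.lintegral_rpow_ne_top hd hs x (r := r)
  obtain ⟨hV0, hVl, -⟩ := hV
  have hd3 : (3 : ℝ) ≤ d := by exact_mod_cast hd
  have hq0 : (0 : ℝ) < (d : ℝ) / 2 := by positivity
  have hu : ∀ x r, ballNorm V x r ^ ((d : ℝ) / 2) =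
      (∫⁻ y in Metric.ball x r, ENNReal.ofReal (V y) ^ ((d : ℝ) / 2)).toReal := by
    intro x r
    rw [ballNorm, ← Real.rpow_mul ENNReal.toReal_nonneg, one_div, inv_mul_cancel₀ hq0.ne',
      Real.rpow_one]
  set q : ℝ := (d : ℝ) / 2 with hq
  -- Three doublings lead from B(y,r/2) to B(y,4r), which contains B(x,2r). The summand 2 forces A >
  -- 1, so that 1 - A^{-q} lies strictly between 0 and 1.
  set A : ℝ := C * (2 ^ b * (2 ^ b * 2 ^ b)) + 2 with hA
  have hA1 : 1 < A := by
    have : 0 < C * (2 ^ b * (2 ^ b * 2 ^ b)) := by positivity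
    linarith
  have hAq : 1 < A ^ q := Real.one_lt_rpow hA1 hq0
  have hκ0 : 0 < 1 - (A ^ q)⁻¹ := by
    rw [sub_pos]; exact inv_lt_one_of_one_lt₀ hAq
  have hκ1 : 1 - (A ^ q)⁻¹ < 1 := by
    have : 0 < (A ^ q)⁻¹ := by positivity
    linarith
  refine ⟨-Real.logb 2 (1 - (A ^ q)⁻¹), ?_, fun x r hr => ?_⟩
  · rw [neg_pos]; exact Real.logb_neg (by norm_num) hκ0 hκ1
  rw [neg_neg, Real.rpow_logb (by norm_num) (by norm_num) hκ0]
  obtain ⟨y, hy⟩ := exists_dist_eq_of_three_le hd x (3 * r / 2) (by positivity)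
  have hsub1 : Metric.ball x (2 * r) ⊆ Metric.ball y (2 * (2 * r)) := by
    refine Metric.ball_subset_ball' ?_
    rw [dist_comm, hy]; linarith
  have hsub2 : Metric.ball y (r / 2) ⊆ Metric.ball x (2 * r) := by
    refine Metric.ball_subset_ball' ?_
    rw [hy]; linarith
  have hdisj : Disjoint (Metric.ball x r) (Metric.ball y (r / 2)) := by
    refine Metric.ball_disjoint_ball ?_
    rw [dist_comm, hy]; linarith
  have h1 : ballNorm V x (2 * r) ≤ A * ballNorm V y (r / 2) := by
    have e1 := (hcomp x (2 * r) (by positivity)).2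
    have e2 := (hcomp y (r / 2) (by positivity)).1
    have e3 : ballMass V x (2 * r) ≤ 2 ^ b * (2 ^ b * 2 ^ b) * ballMass V y (r / 2) := by
      refine (ballMass_mono hV0 hVl hsub1).trans ?_
      have f1 := hdoub y (2 * r) (by positivity)
      have f2 := hdoub y r hr
      have f3 := hdoub y (r / 2) (by positivity)
      rw [mul_div_cancel₀ r two_ne_zero] at f3
      refine f1.trans ?_
      rw [mul_assoc, mul_assoc]
      refine mul_le_mul_of_nonneg_left (f2.trans ?_) (by positivity)
      exact mul_le_mul_of_nonneg_left f3 (by positivity)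
    have e4 : (r / 2) ^ (d - 2) ≤ (2 * r) ^ (d - 2) := by
      gcongr
      linarith
    have hn := ballNorm_nonneg V y (r / 2)
    have hkp : 0 < k * (2 * r) ^ (d - 2) := by positivity
    have e5 : k * (2 * r) ^ (d - 2) * ballNorm V x (2 * r) ≤
        k * (2 * r) ^ (d - 2) * (A * ballNorm V y (r / 2)) := by
      calc _ ≤ C * ballMass V x (2 * r) := e1
        _ ≤ C * (2 ^ b * (2 ^ b * 2 ^ b) * ballMass V y (r / 2)) := by gcongr
        _ ≤ C * (2 ^ b * (2 ^ b * 2 ^ b) * (k * (r / 2) ^ (d - 2) * ballNorm V y (r / 2))) := by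
            gcongr
        _ ≤ C * (2 ^ b * (2 ^ b * 2 ^ b) * (k * (2 * r) ^ (d - 2) * ballNorm V y (r / 2))) := by
            gcongr
        _ = k * (2 * r) ^ (d - 2) * (C * (2 ^ b * (2 ^ b * 2 ^ b)) * ballNorm V y (r / 2)) := by
            ring
        _ ≤ _ := by
            gcongr
            linarith
    exact le_of_mul_le_mul_left e5 hkp
  have h2 : ballNorm V x r ^ q + ballNorm V y (r / 2) ^ q ≤ ballNorm V x (2 * r) ^ q := by
    rw [hu, hu, hu, ← ENNReal.toReal_add (hfin x r hr) (hfin y _ (by positivity))]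
    refine ENNReal.toReal_mono (hfin x _ (by positivity)) ?_
    rw [← lintegral_union measurableSet_ball hdisj]
    exact lintegral_mono_set (Set.union_subset (Metric.ball_subset_ball (by linarith)) hsub2)
  have h3 : ballNorm V x (2 * r) ^ q ≤ A ^ q * ballNorm V y (r / 2) ^ q := by
    rw [← Real.mul_rpow (by linarith) (ballNorm_nonneg _ _ _)]
    exact Real.rpow_le_rpow (ballNorm_nonneg _ _ _) h1 hq0.le
  have h4 : (A ^ q)⁻¹ * ballNorm V x (2 * r) ^ q ≤ ballNorm V y (r / 2) ^ q := by
    rw [inv_mul_le_iff₀ (by positivity)]; exact h3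
  linarith

/-- Since |B|^{1-2/d} is proportional to r^{d-2}, the normalized mass is comparable to the L^{d/2}
norm and inherits its decay. At s = d/2 a direct use of Hölder and monotonicity of the norm would
only give ε = 0; the reverse doubling of the norm supplies ε > 0. -/
theorem ReverseHolder.ballMass_decay (hd : 3 ≤ d) {s : ℝ≥0∞} (hs : (d : ℝ≥0∞) / 2 ≤ s)
    {V : E d → ℝ} (hV : ReverseHolder s V) :
    ∃ C ε : ℝ, 0 < C ∧ 0 < ε ∧ ∀ (x : E d) (r R : ℝ), 0 < r → r ≤ R →
      1 / r ^ (d - 2) * ballMass V x r ≤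
        C * (r / R) ^ ε * (1 / R ^ (d - 2) * ballMass V x R) := by
  obtain ⟨k, C, hk, hC, hcomp⟩ := hV.ballNorm_comparable hd hs
  obtain ⟨a, ha, hdec⟩ := hV.ballNorm_rpow_two_mul hd hs
  have hfin := fun x r => hV.lintegral_rpow_ne_top hd hs x (r := r)
  have hd3 : (3 : ℝ) ≤ d := by exact_mod_cast hd
  have hq0 : (0 : ℝ) < (d : ℝ) / 2 := by positivity
  set q : ℝ := (d : ℝ) / 2 with hq
  refine ⟨(2 ^ a) ^ (1 / q) * C, a * (1 / q), by positivity, by positivity, fun x r R hr hrR => ?_⟩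
  have hR : 0 < R := hr.trans_le hrR
  have h1 := le_rpow_mul_of_le_two_mul (w := fun r => ballNorm V x r ^ q)
    (fun r R hr hrR => by
      refine Real.rpow_le_rpow (ballNorm_nonneg _ _ _) ?_ hq0.le
      refine Real.rpow_le_rpow ENNReal.toReal_nonneg ?_ (by positivity)
      exact ENNReal.toReal_mono (hfin x R (hr.trans_le hrR))
        (lintegral_mono_set (Metric.ball_subset_ball hrR)))
    (fun r _ => Real.rpow_nonneg (ballNorm_nonneg _ _ _) _) ha.le (hdec x) hr hrR
  have h2 : ballNorm V x r ≤ (2 ^ a) ^ (1 / q) * (r / R) ^ (a * (1 / q)) * ballNorm V x R := by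
    have := Real.rpow_le_rpow (Real.rpow_nonneg (ballNorm_nonneg _ _ _) _) h1
      (by positivity : 0 ≤ 1 / q)
    rwa [Real.mul_rpow (by positivity) (Real.rpow_nonneg (ballNorm_nonneg _ _ _) _),
      Real.mul_rpow (by positivity) (by positivity), ← Real.rpow_mul (ballNorm_nonneg _ _ _),
      ← Real.rpow_mul (ballNorm_nonneg _ _ _), ← Real.rpow_mul (by positivity : 0 ≤ r / R),
      mul_one_div_cancel hq0.ne', Real.rpow_one, Real.rpow_one] at this
  have e1 : 1 / r ^ (d - 2) * ballMass V x r ≤ k * ballNorm V x r := by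
    rw [one_div, inv_mul_le_iff₀ (by positivity)]
    exact (hcomp x r hr).1.trans (le_of_eq (by ring))
  have e2 : k * ballNorm V x R ≤ C * (1 / R ^ (d - 2) * ballMass V x R) := by
    have := (hcomp x R hR).2
    have hR' : 0 < R ^ (d - 2) := by positivity
    rw [one_div, ← mul_assoc, mul_comm C, mul_assoc, le_inv_mul_iff₀ hR']
    exact (le_of_eq (by ring)).trans this
  calc _ ≤ k * ballNorm V x r := e1
    _ ≤ k * ((2 ^ a) ^ (1 / q) * (r / R) ^ (a * (1 / q)) * ballNorm V x R) := by gcongr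
    _ = (2 ^ a) ^ (1 / q) * (r / R) ^ (a * (1 / q)) * (k * ballNorm V x R) := by ring
    _ ≤ (2 ^ a) ^ (1 / q) * (r / R) ^ (a * (1 / q)) *
        (C * (1 / R ^ (d - 2) * ballMass V x R)) := by gcongr
    _ = _ := by ring

theorem ReverseHolder.ballMass_growth (hd : 3 ≤ d) {s : ℝ≥0∞} (hs : (d : ℝ≥0∞) / 2 ≤ s)
    {V : E d → ℝ} (hV : ReverseHolder s V) :
    ∃ b : ℝ, 0 ≤ b ∧ ∀ (x : E d) (r R : ℝ), 0 < r → r ≤ R →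
      ballMass V x R ≤ 2 ^ b * (R / r) ^ b * ballMass V x r := by
  obtain ⟨b, hb, hdoub⟩ := hV.ballMass_two_mul_le hd hs
  refine ⟨b, hb, fun x r R hr hrR => le_rpow_mul_of_two_mul_le (fun r R _ hrR => ?_)
    (fun r _ => ballMass_nonneg hV.1 x r) hb (hdoub x) hr hrR⟩
  exact ballMass_mono hV.1 hV.2.1 (Metric.ball_subset_ball hrR)

/-- By doubling, a massless ball makes every concentric larger ball massless, and then `V` vanishes
a.e. -/
theorem ReverseHolder.ballMass_pos (hd : 3 ≤ d) {s : ℝ≥0∞} (hs : (d : ℝ≥0∞) / 2 ≤ s)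
    {V : E d → ℝ} (hV : ReverseHolder s V) (hVne : ¬ V =ᵐ[volume] 0) (x : E d) {r : ℝ}
    (hr : 0 < r) : 0 < ballMass V x r := by
  obtain ⟨b, -, hgrow⟩ := hV.ballMass_growth hd hs
  obtain ⟨hV0, hVl, -⟩ := hV
  refine (ballMass_nonneg hV0 x r).lt_of_ne fun h0 => hVne ?_
  have hz : ∀ n : ℕ, ballMass V x n = 0 := by
    intro n
    refine le_antisymm ?_ (ballMass_nonneg hV0 x n)
    have h1 := hgrow x r (max r n) hr (le_max_left _ _)
    rw [← h0, mul_zero] at h1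
    exact (ballMass_mono hV0 hVl (Metric.ball_subset_ball (le_max_right _ _))).trans h1
  have h1 : ∀ᵐ y ∂(volume.restrict (⋃ n : ℕ, Metric.ball x n)), V y = 0 := by
    rw [ae_restrict_iUnion_iff]
    intro n
    have h2 := ofReal_ballMass hV0 hVl x n
    rw [hz n, ENNReal.ofReal_zero, eq_comm, lintegral_eq_zero_iff'
      hVl.aestronglyMeasurable.aemeasurable.ennreal_ofReal.restrict] at h2
    filter_upwards [h2] with y hy
    exact le_antisymm (ENNReal.ofReal_eq_zero.1 hy) (hV0 y)
  rw [Metric.iUnion_ball_nat, Measure.restrict_univ] at h1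
  exact h1

/-! ### Critical radius and its slow variation -/

/-- The radii admissible in the definition of the critical radius. -/
def admissibleRadii (V : E d → ℝ) (x : E d) : Set ℝ :=
  {r : ℝ | 0 < r ∧ 1 / r ^ (d - 2) * ∫ y in Metric.ball x r, V y ≤ 1}

/-- Decay below radius 1 makes the normalized mass tend to 0 as the radius does. -/
theorem ReverseHolder.admissibleRadii_nonempty (hd : 3 ≤ d) {s : ℝ≥0∞}
    (hs : (d : ℝ≥0∞) / 2 ≤ s) {V : E d → ℝ} (hV : ReverseHolder s V) (x : E d) :
    (admissibleRadii V x).Nonempty := by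
  obtain ⟨C, ε, hC, hε, hdec⟩ := hV.ballMass_decay hd hs
  have h1 : Filter.Tendsto (fun r : ℝ => C * (r / 1) ^ ε * (1 / 1 ^ (d - 2) * ballMass V x 1))
      (nhdsWithin 0 (Set.Ioi 0)) (nhds (C * (0 / 1) ^ ε * (1 / 1 ^ (d - 2) * ballMass V x 1))) := by
    refine Filter.Tendsto.mono_left ?_ nhdsWithin_le_nhds
    refine Filter.Tendsto.mul_const _ (Filter.Tendsto.const_mul _ ?_)
    exact (Filter.tendsto_id.div_const 1).rpow_const (Or.inr hε.le)
  rw [zero_div, Real.zero_rpow hε.ne', mul_zero, zero_mul] at h1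
  obtain ⟨r, hr1, hr2⟩ := ((h1.eventually (Iic_mem_nhds one_pos)).and
    (Ioo_mem_nhdsGT (one_pos : (0 : ℝ) < 1))).exists
  exact ⟨r, hr2.1, (hdec x r 1 hr2.1 hr2.2.le).trans hr1⟩

/-- Decay read from R down to 1 shows that the normalized mass grows at least like R^ε, since the
mass of the unit ball is positive. -/
theorem ReverseHolder.admissibleRadii_bddAbove (hd : 3 ≤ d) {s : ℝ≥0∞}
    (hs : (d : ℝ≥0∞) / 2 ≤ s) {V : E d → ℝ} (hV : ReverseHolder s V) (hVne : ¬ V =ᵐ[volume] 0)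
    (x : E d) : BddAbove (admissibleRadii V x) := by
  obtain ⟨C, ε, hC, hε, hdec⟩ := hV.ballMass_decay hd hs
  have hv := hV.ballMass_pos hd hs hVne x one_pos
  refine ⟨max 1 ((C / ballMass V x 1) ^ (1 / ε)), fun R hR => ?_⟩
  rcases le_total R 1 with h | h
  · exact le_max_of_le_left h
  refine le_max_of_le_right ?_
  have hR0 : 0 < R := hR.1
  have h1 := hdec x 1 R one_pos h
  have h2 : C * (1 / R) ^ ε * (1 / R ^ (d - 2) * ballMass V x R) ≤ C * (1 / R) ^ ε * 1 :=
    mul_le_mul_of_nonneg_left hR.2 (by positivity)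
  have h3 : ballMass V x 1 ≤ C * (1 / R) ^ ε := by
    have := h1.trans h2
    simpa using this
  rw [one_div R, Real.inv_rpow hR0.le, ← div_eq_mul_inv, le_div_iff₀ (by positivity), mul_comm,
    ← le_div_iff₀ hv] at h3
  calc R = (R ^ ε) ^ (1 / ε) := by
        rw [← Real.rpow_mul hR0.le, mul_one_div_cancel hε.ne', Real.rpow_one]
    _ ≤ _ := Real.rpow_le_rpow (by positivity) h3 (by positivity)

theorem ReverseHolder.criticalRadius_pos (hd : 3 ≤ d) {s : ℝ≥0∞} (hs : (d : ℝ≥0∞) / 2 ≤ s)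
    {V : E d → ℝ} (hV : ReverseHolder s V) (hVne : ¬ V =ᵐ[volume] 0) (x : E d) :
    0 < criticalRadius V x := by
  obtain ⟨r, hr⟩ := hV.admissibleRadii_nonempty hd hs x
  exact hr.1.trans_le (le_csSup (hV.admissibleRadii_bddAbove hd hs hVne x) hr)

/-- The critical radius varies slowly: `ρ(x)` is bounded below by `ρ(x₀)` up to a power of
`1 + |x - x₀| / ρ(x₀)`. -/
theorem ReverseHolder.le_criticalRadius (hd : 3 ≤ d) {s : ℝ≥0∞} (hs : (d : ℝ≥0∞) / 2 ≤ s)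
    {V : E d → ℝ} (hV : ReverseHolder s V) (hVne : ¬ V =ᵐ[volume] 0) :
    ∃ c m : ℝ, 0 < c ∧ 0 ≤ m ∧ ∀ x₀ x : E d,
      c * criticalRadius V x₀ * (1 + dist x x₀ / criticalRadius V x₀) ^ (-m) ≤
        criticalRadius V x := by
  obtain ⟨C, ε, hC, hε, hdec⟩ := hV.ballMass_decay hd hs
  obtain ⟨b, hb, hgrow⟩ := hV.ballMass_growth hd hs
  set K : ℝ := max 1 (C * 8 ^ b) with hK
  have hK1 : 1 ≤ K := le_max_left _ _
  refine ⟨K ^ (-(1 / ε)), b / ε, by positivity, by positivity, fun x₀ x => ?_⟩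
  have hρ0 : 0 < criticalRadius V x₀ := hV.criticalRadius_pos hd hs hVne x₀
  set ρ₀ := criticalRadius V x₀ with hρ
  -- Attainment of the supremum is not needed: an admissible radius in (ρ₀/2, ρ₀] suffices.
  obtain ⟨r, hr, hrρ⟩ := exists_lt_of_lt_csSup (hV.admissibleRadii_nonempty hd hs x₀)
    (show ρ₀ / 2 < sSup (admissibleRadii V x₀) from half_lt_self hρ0)
  have hrle : r ≤ ρ₀ := le_csSup (hV.admissibleRadii_bddAbove hd hs hVne x₀) hr
  have hr0 : 0 < r := hr.1
  set D := dist x x₀ with hD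
  have hD0 : 0 ≤ D := dist_nonneg
  set R := D + ρ₀ with hR
  have hR0 : 0 < R := by positivity
  set Ψ := 1 + D / ρ₀ with hΨ
  have hΨ1 : 1 ≤ Ψ := le_add_of_nonneg_right (by positivity)
  have hΨR : R / ρ₀ = Ψ := by rw [hR, hΨ, add_div, div_self hρ0.ne', add_comm]
  have hKΨ : 1 ≤ K * Ψ ^ b := one_le_mul_of_one_le_of_one_le hK1 (Real.one_le_rpow hΨ1 hb)
  -- Chosen so that the decay factor C σ^ε cancels the bound 8^b Ψ^b for the normalized mass of
  -- B(x,R); then Rσ is admissible at x.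
  set σ := (K * Ψ ^ b) ^ (-(1 / ε)) with hσ
  have hσ0 : 0 < σ := by positivity
  have hσ1 : σ ≤ 1 := Real.rpow_le_one_of_one_le_of_nonpos hKΨ (by
    rw [neg_nonpos]; positivity)
  have hσε : σ ^ ε = (K * Ψ ^ b)⁻¹ := by
    rw [hσ, ← Real.rpow_mul (by positivity), neg_mul, one_div, inv_mul_cancel₀ hε.ne',
      Real.rpow_neg_one]
  -- B(x,R) lies in B(x₀,2R), and 2R/r ≤ 4Ψ because r > ρ₀/2. Growth costs (2 · 4Ψ)^b, whence the 8.
  have h1 : 1 / R ^ (d - 2) * ballMass V x R ≤ 8 ^ b * Ψ ^ b := by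
    have e1 : ballMass V x R ≤ ballMass V x₀ (2 * R) := by
      refine ballMass_mono hV.1 hV.2.1 (Metric.ball_subset_ball' ?_)
      linarith
    have e2 := hgrow x₀ r (2 * R) hr0 (by linarith)
    have e3 : ballMass V x₀ r ≤ R ^ (d - 2) := by
      have h := hr.2
      rw [one_div, inv_mul_le_iff₀ (by positivity), mul_one] at h
      refine h.trans ?_
      gcongr
      linarith
    have e4 : 2 * R / r ≤ 4 * Ψ := by
      rw [← hΨR, div_le_iff₀ hr0]
      have : 4 * (R / ρ₀) * (ρ₀ / 2) = 2 * R := by field_simp; ring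
      rw [← this]
      gcongr
    have e5 := ballMass_nonneg hV.1 x₀ r
    rw [one_div, inv_mul_le_iff₀ (by positivity)]
    calc ballMass V x R ≤ 2 ^ b * (2 * R / r) ^ b * ballMass V x₀ r := e1.trans e2
      _ ≤ 2 ^ b * (4 * Ψ) ^ b * R ^ (d - 2) := by gcongr
      _ = R ^ (d - 2) * (8 ^ b * Ψ ^ b) := by
        rw [Real.mul_rpow (by norm_num) (by positivity), show (8 : ℝ) = 2 * 4 by norm_num,
          Real.mul_rpow (by norm_num) (by norm_num)]
        ring
  have h2 : R * σ ∈ admissibleRadii V x := by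
    refine ⟨by positivity, ?_⟩
    have e1 := hdec x (R * σ) R (by positivity) (mul_le_of_le_one_right hR0.le hσ1)
    refine e1.trans ?_
    rw [mul_div_cancel_left₀ _ hR0.ne', hσε]
    calc C * (K * Ψ ^ b)⁻¹ * (1 / R ^ (d - 2) * ballMass V x R)
        ≤ C * (K * Ψ ^ b)⁻¹ * (8 ^ b * Ψ ^ b) := by gcongr
      _ = (C * 8 ^ b) / K := by field_simp
      _ ≤ 1 := by rw [div_le_one (by positivity)]; exact le_max_right _ _
  have h3 : R * σ ≤ criticalRadius V x :=
    le_csSup (hV.admissibleRadii_bddAbove hd hs hVne x) h2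
  refine le_trans ?_ h3
  calc K ^ (-(1 / ε)) * ρ₀ * Ψ ^ (-(b / ε)) = ρ₀ * σ := by
        rw [hσ, Real.mul_rpow (by positivity) (by positivity), ← Real.rpow_mul (by positivity)]
        ring_nf
    _ ≤ R * σ := by gcongr; linarith

/-- The quantities `1 + r / ρ` at nearby points are polynomially comparable. -/
theorem ReverseHolder.exists_one_add_div_criticalRadius_le (hd : 3 ≤ d) {s : ℝ≥0∞}
    (hs : (d : ℝ≥0∞) / 2 ≤ s) {V : E d → ℝ} (hV : ReverseHolder s V) (hVne : ¬ V =ᵐ[volume] 0) :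
    ∃ C N : ℝ, 0 < C ∧ 0 < N ∧ ∀ (x₀ x : E d) (r : ℝ), 0 < r → dist x x₀ ≤ r →
      1 + r / criticalRadius V x ≤ C * (1 + r / criticalRadius V x₀) ^ N := by
  obtain ⟨c, m, hc, hm, h⟩ := hV.le_criticalRadius hd hs hVne
  refine ⟨1 + c⁻¹, m + 1, by positivity, by positivity, fun x₀ x r hr hx => ?_⟩
  have hρ0 := hV.criticalRadius_pos hd hs hVne x₀
  have hρ := hV.criticalRadius_pos hd hs hVne x
  have h1 := h x₀ x
  set ρ₀ := criticalRadius V x₀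
  set ρ := criticalRadius V x
  set Ψ := 1 + r / ρ₀ with hΨ
  have hrρ : 0 < r / ρ₀ := by positivity
  have hΨ1 : 1 ≤ Ψ := by linarith
  have h2 : c * ρ₀ * Ψ ^ (-m) ≤ ρ := by
    refine le_trans ?_ h1
    refine mul_le_mul_of_nonneg_left ?_ (by positivity)
    refine Real.rpow_le_rpow_of_nonpos (by positivity) ?_ (by linarith)
    change 1 + dist x x₀ / ρ₀ ≤ 1 + r / ρ₀
    gcongr
  have h3 : r / ρ ≤ c⁻¹ * Ψ ^ (m + 1) := by
    rw [div_le_iff₀ hρ]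
    calc r = c⁻¹ * (r / ρ₀ * Ψ ^ m) * (c * ρ₀ * Ψ ^ (-m)) := by
          rw [Real.rpow_neg (by positivity)]
          field_simp
      _ ≤ c⁻¹ * (Ψ * Ψ ^ m) * ρ := by
          gcongr
          linarith
      _ = c⁻¹ * Ψ ^ (m + 1) * ρ := by
          rw [Real.rpow_add (by positivity), Real.rpow_one]; ring
  have h4 : 1 ≤ Ψ ^ (m + 1) := Real.one_le_rpow hΨ1 (by positivity)
  calc 1 + r / ρ ≤ Ψ ^ (m + 1) + c⁻¹ * Ψ ^ (m + 1) := add_le_add h4 h3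
    _ = _ := by ring

/-! ### Cubes, differentiation and the dyadic grid -/

/-- The half-open cube with centre `z` and side length `s`. -/
def halfOpenCube (z : E d) (s : ℝ) : Set (E d) := {y | ∀ i, z i - s / 2 ≤ y i ∧ y i < z i + s / 2}

theorem measurableSet_cube (z : E d) (s : ℝ) : MeasurableSet (cube z s) := by
  have : cube z s = ⋂ i, {x : E d | |x i - z i| < s / 2} := by ext; simp [cube]
  rw [this]
  refine MeasurableSet.iInter fun i => measurableSet_lt ?_ measurable_const
  fun_prop

theorem cube_eq_preimage (z : E d) (s : ℝ) :
    cube z s = WithLp.ofLp ⁻¹' (Set.univ.pi fun i => Set.Ioo (z i - s / 2) (z i + s / 2)) := by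
  ext y
  simp only [cube, Set.mem_ofPred_eq, Set.mem_preimage, Set.mem_univ_pi, Set.mem_Ioo, abs_lt]
  refine forall_congr' fun i => ?_
  constructor <;> rintro ⟨h1, h2⟩ <;> constructor <;> linarith

theorem halfOpenCube_eq_preimage (z : E d) (s : ℝ) :
    halfOpenCube z s =
      WithLp.ofLp ⁻¹' (Set.univ.pi fun i => Set.Ico (z i - s / 2) (z i + s / 2)) := by
  ext y
  simp [halfOpenCube]

theorem cube_ae_eq_halfOpenCube (z : E d) (s : ℝ) : cube z s =ᵐ[volume] halfOpenCube z s := by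
  rw [cube_eq_preimage, halfOpenCube_eq_preimage]
  exact (PiLp.volume_preserving_ofLp (Fin d)).quasiMeasurePreserving.preimage_ae_eq
    (Measure.univ_pi_Ioo_ae_eq_Icc.trans Measure.univ_pi_Ico_ae_eq_Icc.symm)

theorem preimage_closedBall_ae_eq_halfOpenCube (z : E d) {s : ℝ} (hs : 0 < s) :
    WithLp.ofLp ⁻¹' (Metric.closedBall (WithLp.ofLp z) (s / 2)) =ᵐ[volume] halfOpenCube z s := by
  rw [halfOpenCube_eq_preimage, closedBall_pi _ (by positivity)]
  simp only [Real.closedBall_eq_Icc, Set.pi_univ_Icc]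
  exact (PiLp.volume_preserving_ofLp (Fin d)).quasiMeasurePreserving.preimage_ae_eq
    Measure.univ_pi_Ico_ae_eq_Icc.symm

theorem volume_cube (z : E d) (s : ℝ) : volume (cube z s) = ENNReal.ofReal s ^ d := by
  rw [cube_eq_preimage, (PiLp.volume_preserving_ofLp (Fin d)).measure_preimage
    (MeasurableSet.univ_pi fun i => measurableSet_Ioo).nullMeasurableSet, Real.volume_pi_Ioo]
  simp

theorem volume_cube_ne_zero (z : E d) {s : ℝ} (hs : 0 < s) : volume (cube z s) ≠ 0 := by
  rw [volume_cube]
  exact pow_ne_zero _ (by simpa using hs)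

theorem volume_cube_ne_top (z : E d) (s : ℝ) : volume (cube z s) ≠ ∞ := by
  rw [volume_cube]
  exact ENNReal.pow_ne_top ENNReal.ofReal_ne_top

/-- Lebesgue differentiation along shrinking cubes. -/
theorem ae_tendsto_lintegral_halfOpenCube {g : E d → ℝ≥0∞} (hg : AEMeasurable g volume)
    (hgi : ∫⁻ x, g x ≠ ∞) :
    ∀ᵐ x : E d, ∀ (z : ℕ → E d) (s : ℕ → ℝ),
      Filter.Tendsto s Filter.atTop (nhdsWithin 0 (Set.Ioi 0)) →
      (∀ n, 0 < s n) → (∀ n, x ∈ halfOpenCube (z n) (s n)) →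
      Filter.Tendsto (fun n => (∫⁻ y in halfOpenCube (z n) (s n), g y) /
        volume (halfOpenCube (z n) (s n))) Filter.atTop (nhds (g x)) := by
  have hpres := PiLp.volume_preserving_ofLp (Fin d)
  have hpres' := PiLp.volume_preserving_toLp (Fin d)
  have hemb : MeasurableEmbedding (WithLp.ofLp : E d → Fin d → ℝ) :=
    (MeasurableEquiv.toLp 2 (Fin d → ℝ)).symm.measurableEmbedding
  have hemb' : MeasurableEmbedding (WithLp.toLp 2 : (Fin d → ℝ) → E d) :=
    (MeasurableEquiv.toLp 2 (Fin d → ℝ)).measurableEmbedding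
  set G : (Fin d → ℝ) → ℝ≥0∞ := fun y => g (WithLp.toLp 2 y) with hG
  have hGm : AEMeasurable G volume := hg.comp_quasiMeasurePreserving hpres'.quasiMeasurePreserving
  have hGi : ∫⁻ y, G y ≠ ∞ := by
    rw [hG, hpres'.lintegral_comp_emb hemb']
    exact hgi
  -- In the sup norm cubes are balls. The parameter 1 of the Vitali family admits balls that contain
  -- the point without being centred at it.
  have h1 := VitaliFamily.ae_tendsto_lintegral_div
    (IsUnifLocDoublingMeasure.vitaliFamily (volume : Measure (Fin d → ℝ)) 1) hGm hGi
  filter_upwards [hpres.quasiMeasurePreserving.ae h1] with x hx z s hs hs0 hmem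
  have hlim : Filter.Tendsto (fun n => s n / 2) Filter.atTop (nhdsWithin 0 (Set.Ioi 0)) := by
    rw [tendsto_nhdsWithin_iff] at hs ⊢
    refine ⟨by simpa using hs.1.div_const 2, Filter.Eventually.of_forall fun n => ?_⟩
    exact half_pos (hs0 n)
  have h2 := hx.comp (IsUnifLocDoublingMeasure.tendsto_closedBall_filterAt volume
    (fun n => WithLp.ofLp (z n)) (fun n => s n / 2) hlim (Filter.Eventually.of_forall fun n => by
      rw [one_mul, closedBall_pi _ (half_pos (hs0 n)).le, Set.mem_univ_pi]
      intro i
      rw [Real.closedBall_eq_Icc]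
      exact ⟨(hmem n i).1, (hmem n i).2.le⟩))
  refine h2.congr fun n => ?_
  simp only [Function.comp]
  have e1 := preimage_closedBall_ae_eq_halfOpenCube (z n) (hs0 n)
  rw [← setLIntegral_congr e1, ← measure_congr e1,
    hpres.measure_preimage measurableSet_closedBall.nullMeasurableSet,
    ← hpres.setLIntegral_comp_preimage_emb hemb]

/-- The index of the dyadic cube of generation `n` containing `x`, for the dyadic subdivision of
the cube with lower corner `a` and side length `r`. -/
def dyadicIndex (a : E d) (r : ℝ) (n : ℕ) (x : E d) : Fin d → ℤ :=
  fun i => ⌊(x i - a i) / (r / 2 ^ n)⌋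

/-- The centre of the dyadic cube with index `k`. -/
def dyadicCenter (a : E d) (r : ℝ) (n : ℕ) (k : Fin d → ℤ) : E d :=
  WithLp.toLp 2 fun i => a i + (k i + 1 / 2) * (r / 2 ^ n)

theorem cellOf_dyadicIndex (a : E d) {r : ℝ} (hr : 0 < r) (n : ℕ) (x : E d) :
    cellOf (dyadicIndex a r) n x =
      halfOpenCube (dyadicCenter a r n (dyadicIndex a r n x)) (r / 2 ^ n) := by
  have hs : 0 < r / 2 ^ n := by positivity
  ext y
  simp only [cellOf, Set.mem_preimage, Set.mem_singleton_iff, halfOpenCube, Set.mem_ofPred_eq]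
  rw [funext_iff]
  refine forall_congr' fun i => ?_
  generalize dyadicIndex a r n x = k
  simp only [dyadicIndex, dyadicCenter, Int.floor_eq_iff, le_div_iff₀ hs, div_lt_iff₀ hs]
  constructor <;> rintro ⟨h1, h2⟩ <;> constructor <;> linarith

theorem measurable_dyadicIndex (a : E d) (r : ℝ) (n : ℕ) : Measurable (dyadicIndex a r n) := by
  refine measurable_pi_lambda _ fun i => Int.measurable_floor.comp ?_
  fun_prop

theorem dyadicIndex_nest (a : E d) (r : ℝ) (n : ℕ) (x y : E d)
    (h : dyadicIndex a r (n + 1) x = dyadicIndex a r (n + 1) y) :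
    dyadicIndex a r n x = dyadicIndex a r n y := by
  have key : ∀ x : E d, ∀ i, dyadicIndex a r n x i = dyadicIndex a r (n + 1) x i / ((2 : ℕ) : ℤ) := by
    intro x i
    rw [dyadicIndex, dyadicIndex, ← Int.floor_div_natCast]
    congr 1
    push_cast
    rw [pow_succ]
    field_simp
  funext i
  rw [key, key, h]

/-- The lower corner of a cube. -/
def lowerCorner (x₀ : E d) (r : ℝ) : E d := WithLp.toLp 2 fun i => x₀ i - r / 2

/-- Anchoring the grid at the lower corner makes the given cube the root of its dyadic tree, up to
boundary faces. -/
theorem cellOf_lowerCorner_zero (x₀ : E d) {r : ℝ} (hr : 0 < r) :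
    cellOf (dyadicIndex (lowerCorner x₀ r) r) 0 x₀ = halfOpenCube x₀ r := by
  rw [cellOf_dyadicIndex _ hr]
  have : dyadicCenter (lowerCorner x₀ r) r 0 (dyadicIndex (lowerCorner x₀ r) r 0 x₀) = x₀ := by
    ext i
    have h1 : ⌊(x₀ i - (x₀ i - r / 2)) / (r / 2 ^ 0)⌋ = 0 := by
      rw [Int.floor_eq_zero_iff, pow_zero, div_one, sub_sub_cancel, div_div, mul_comm, ← div_div,
        div_self hr.ne']
      constructor <;> norm_num
    simp only [dyadicCenter, dyadicIndex, lowerCorner, h1]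
    push_cast
    ring
  rw [this]
  simp

theorem dyadicCenter_mem (a : E d) {r : ℝ} (hr : 0 < r) (n : ℕ) (x : E d) :
    dyadicCenter a r n (dyadicIndex a r n x) ∈ cellOf (dyadicIndex a r) n x := by
  have hs : 0 < r / 2 ^ n := by positivity
  rw [cellOf_dyadicIndex a hr]
  intro i
  constructor <;> linarith

/-! ### Lower oscillation with values in [0, ∞] -/

section LowerOsc

variable {f : E d → ℝ} {S : Set (E d)}

theorem lowerOsc_congr_set {T : Set (E d)} (h : S =ᵐ[volume] T) : lowerOsc f S = lowerOsc f T := by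
  unfold lowerOsc
  rw [Measure.restrict_congr_set h]

theorem ae_essInf_le_coe (f : E d → ℝ) (S : Set (E d)) :
    ∀ᵐ y ∂volume.restrict S, essInf (fun y => (f y : EReal)) (volume.restrict S) ≤ f y :=
  ae_essInf_le

theorem essInf_coe_ne_top (hS : volume S ≠ 0) :
    essInf (fun y => (f y : EReal)) (volume.restrict S) ≠ ⊤ := by
  intro h
  have h1 := ae_essInf_le_coe f S
  rw [h] at h1
  have : (volume.restrict S) ≠ 0 := by simpa [Measure.restrict_eq_zero] using hS
  have := ae_neBot.2 this
  obtain ⟨y, hy⟩ := h1.exists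
  exact absurd hy (not_le.2 (EReal.coe_lt_top _))

theorem lowerOsc_eq_ofReal (hS : volume S ≠ 0)
    (hb : essInf (fun y => (f y : EReal)) (volume.restrict S) ≠ ⊥) (y : E d) :
    lowerOsc f S y =
      ENNReal.ofReal (f y - (essInf (fun y => (f y : EReal)) (volume.restrict S)).toReal) := by
  unfold lowerOsc
  lift essInf (fun y => (f y : EReal)) (volume.restrict S) to ℝ using
    ⟨essInf_coe_ne_top hS, hb⟩ with b
  rw [EReal.toReal_coe, ← EReal.coe_sub, EReal.toENNReal_of_ne_top (EReal.coe_ne_top _),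
    EReal.toReal_coe]

theorem ae_toReal_essInf_le (hS : volume S ≠ 0)
    (hb : essInf (fun y => (f y : EReal)) (volume.restrict S) ≠ ⊥) :
    ∀ᵐ y ∂volume.restrict S,
      (essInf (fun y => (f y : EReal)) (volume.restrict S)).toReal ≤ f y := by
  have h1 := ae_essInf_le_coe f S
  filter_upwards [h1] with y hy
  rw [← EReal.coe_le_coe_iff, EReal.coe_toReal (essInf_coe_ne_top hS) hb]
  exact hy

theorem lowerOsc_eq_top (hb : essInf (fun y => (f y : EReal)) (volume.restrict S) = ⊥) (y : E d) :
    lowerOsc f S y = ∞ := by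
  unfold lowerOsc
  rw [hb, EReal.coe_sub_bot, EReal.toENNReal_top]

/-- An essential infimum -∞ makes `lowerOsc` identically ∞, which no set of positive measure
tolerates. So a finite oscillation allows passing to a real lower bound. -/
theorem essInf_ne_bot_of_lintegral_ne_top {μ : Measure (E d)} (hS : μ S ≠ 0)
    (h : ∫⁻ y in S, lowerOsc f S y ∂μ ≠ ∞) :
    essInf (fun y => (f y : EReal)) (volume.restrict S) ≠ ⊥ := by
  intro hb
  refine h ?_
  simp_rw [lowerOsc_eq_top hb]
  rw [setLIntegral_const, ENNReal.top_mul hS]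

/-- The oscillation is smaller over a smaller set. -/
theorem lowerOsc_anti {T : Set (E d)} (h : S ⊆ T) (y : E d) : lowerOsc f S y ≤ lowerOsc f T y := by
  unfold lowerOsc
  refine EReal.toENNReal_le_toENNReal (EReal.sub_le_sub le_rfl ?_)
  exact essInf_antitone_measure (Measure.absolutelyContinuous_of_le (Measure.restrict_mono h le_rfl))

theorem aemeasurable_lowerOsc (hf : AEMeasurable f volume) (S : Set (E d)) :
    AEMeasurable (lowerOsc f S) volume := by
  unfold lowerOsc
  by_cases hb : essInf (fun y => (f y : EReal)) (volume.restrict S) = ⊥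
  · simp_rw [hb, EReal.coe_sub_bot]
    exact aemeasurable_const
  by_cases ht : essInf (fun y => (f y : EReal)) (volume.restrict S) = ⊤
  · simp_rw [ht, sub_eq_add_neg, EReal.neg_top, EReal.add_bot]
    exact aemeasurable_const
  lift essInf (fun y => (f y : EReal)) (volume.restrict S) to ℝ using ⟨ht, hb⟩ with b
  have : (fun x => ((f x : EReal) - (b : EReal)).toENNReal) = fun x => ENNReal.ofReal (f x - b) := by
    funext x
    rw [← EReal.coe_sub, EReal.toENNReal_of_ne_top (EReal.coe_ne_top _), EReal.toReal_coe]
  rw [this]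
  exact (hf.sub_const b).ennreal_ofReal

end LowerOsc

/-! ### John–Nirenberg inequality on cubes -/

theorem setLIntegral_lowerOsc_congr {μ : Measure (E d)} (hμ : μ ≪ volume) {f : E d → ℝ}
    {S T : Set (E d)} (h : S =ᵐ[volume] T) (p : ℝ) :
    ∫⁻ y in S, lowerOsc f S y ^ p ∂μ = ∫⁻ y in T, lowerOsc f T y ^ p ∂μ := by
  rw [lowerOsc_congr_set h, setLIntegral_congr (hμ.ae_le h)]

/-- The John–Nirenberg inequality on a cube: a bound for the lower oscillation over all subcubes
controls the `p`-th moment with respect to a measure of Muckenhoupt type. -/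
theorem setLIntegral_cube_lowerOsc_rpow_le {x₀ : E d} {r : ℝ} (hr : 0 < r) {f : E d → ℝ}
    (hf : AEMeasurable f volume) {ν : Measure (E d)} (hν : ν ≪ volume)
    (hνfin : ν (cube x₀ r) ≠ ∞) {M : ℝ≥0∞} {τ p : ℝ} (hp : 1 ≤ p) (hM0 : M ≠ 0) (hMt : M ≠ ∞)
    (hτ0 : 0 ≤ τ) (hτ1 : τ < 1)
    (hosc : ∀ (z : E d) (s : ℝ), 0 < s → s ≤ r → (∀ i, |z i - x₀ i| ≤ r / 2) →
      avg (cube z s) (lowerOsc f (cube z s)) ≤ M)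
    (hhalf : ∀ (z : E d) (s : ℝ), 0 < s → s ≤ r → (∀ i, |z i - x₀ i| ≤ r / 2) →
      ∀ S ⊆ cube z s, MeasurableSet S → 2 * volume S ≤ volume (cube z s) →
        ν S ≤ ENNReal.ofReal τ ^ p * ν (cube z s)) :
    ∫⁻ y in cube x₀ r, lowerOsc f (cube x₀ r) y ^ p ∂ν ≤
      (4 * 2 ^ d * M * ENNReal.ofReal (1 - τ)⁻¹) ^ p * ν (cube x₀ r) := by
  set a := lowerCorner x₀ r with ha
  set π := dyadicIndex a r with hπ
  set Q := cellOf π 0 x₀ with hQ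
  have hQ' : Q = halfOpenCube x₀ r := cellOf_lowerCorner_zero x₀ hr
  have hnest : ∀ n x y, π (n + 1) x = π (n + 1) y → π n x = π n y := dyadicIndex_nest a r
  have hstable : ∀ n, ∀ x ∈ Q, cellOf π n x ⊆ Q := by
    intro n x hx
    rw [hQ, ← cellOf_eq_of_mem hx]
    exact cellOf_anti hnest (Nat.zero_le n) x
  let ctr : ℕ → E d → E d := fun n x => dyadicCenter a r n (π n x)
  have hside : ∀ n : ℕ, 0 < r / 2 ^ n := fun n => by positivity
  have hside' : ∀ n : ℕ, r / 2 ^ n ≤ r := fun n => div_le_self hr.le (one_le_pow₀ (by norm_num))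
  have hcell : ∀ n x, cellOf π n x = halfOpenCube (ctr n x) (r / 2 ^ n) := fun n x =>
    cellOf_dyadicIndex a hr n x
  -- The hypotheses concern open cubes and the cells are half-open; the difference is Lebesgue null,
  -- hence also `ν`-null.
  have hae : ∀ n x, cube (ctr n x) (r / 2 ^ n) =ᵐ[volume] cellOf π n x := fun n x => by
    rw [hcell]; exact cube_ae_eq_halfOpenCube _ _
  have hctr : ∀ n, ∀ x ∈ Q, ∀ i, |ctr n x i - x₀ i| ≤ r / 2 := by
    intro n x hx i
    have h1 : ctr n x ∈ halfOpenCube x₀ r := hQ' ▸ hstable n x hx (dyadicCenter_mem a hr n x)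
    rw [abs_le]
    constructor <;> linarith [(h1 i).1, (h1 i).2]
  have hmeas : ∀ n k, MeasurableSet (π n ⁻¹' {k}) := fun n k =>
    measurable_dyadicIndex a r n (measurableSet_singleton k)
  have hvol : ∀ n x, volume (cellOf π n x) = ENNReal.ofReal (r / 2 ^ n) ^ d := fun n x => by
    rw [← measure_congr (hae n x), volume_cube]
  have hpos : ∀ n x, volume (cellOf π n x) ≠ 0 := fun n x => by
    rw [← measure_congr (hae n x)]; exact volume_cube_ne_zero _ (hside n)
  have hfin : ∀ n x, volume (cellOf π n x) ≠ ∞ := fun n x => by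
    rw [← measure_congr (hae n x)]; exact volume_cube_ne_top _ _
  have hoscL : ∀ n, ∀ x ∈ Q, ∫⁻ y in cellOf π n x, lowerOsc f (cellOf π n x) y ≤
      M * volume (cellOf π n x) := by
    intro n x hx
    have h1 := hosc (ctr n x) _ (hside n) (hside' n) (hctr n x hx)
    rw [avg, lowerOsc_congr_set (hae n x), setLIntegral_congr (hae n x), measure_congr (hae n x)]
      at h1
    exact (ENNReal.div_le_iff (hpos n x) (hfin n x)).1 h1
  have hbot : ∀ n, ∀ x ∈ Q,
      essInf (fun y => (f y : EReal)) (volume.restrict (cellOf π n x)) ≠ ⊥ := fun n x hx =>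
    essInf_ne_bot_of_lintegral_ne_top (hpos n x)
      (ne_top_of_le_ne_top (ENNReal.mul_ne_top hMt (hfin n x)) (hoscL n x hx))
  -- On the cells inside `Q` the infimum is finite by `hbot`, so the default value of `toReal` does
  -- not enter there.
  let b : ℕ → (Fin d → ℤ) → ℝ := fun n k =>
    (essInf (fun y => (f y : EReal)) (volume.restrict (π n ⁻¹' {k}))).toReal
  have hlow : ∀ n, ∀ x ∈ Q, ∀ y, lowerOsc f (cellOf π n x) y =
      ENNReal.ofReal (f y - b n (π n x)) := fun n x hx =>
    lowerOsc_eq_ofReal (hpos n x) (hbot n x hx)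
  have hoscb : ∀ n, ∀ x ∈ Q, ∫⁻ y in cellOf π n x, ENNReal.ofReal (f y - b n (π n x)) ≤
      M * volume (cellOf π n x) := fun n x hx => by
    simp_rw [← hlow n x hx]
    exact hoscL n x hx
  have hside_lim : Filter.Tendsto (fun m : ℕ => r / 2 ^ m) Filter.atTop
      (nhdsWithin 0 (Set.Ioi 0)) := by
    rw [tendsto_nhdsWithin_iff]
    refine ⟨?_, Filter.Eventually.of_forall hside⟩
    have := (tendsto_pow_atTop_nhds_zero_of_lt_one (by norm_num : (0 : ℝ) ≤ 1 / 2)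
      (by norm_num)).const_mul r
    rw [mul_zero] at this
    refine this.congr fun m => ?_
    rw [one_div, inv_pow, div_eq_mul_inv]
  have hD : DyadicBLO π volume ν Q f b M (2 ^ d) τ p :=
    { meas := hmeas
      nest := hnest
      stable := hstable
      pos := fun n x _ => hpos n x
      fin := fun n x _ => hfin n x
      doubling := fun n x _ => by
        rw [hvol, hvol, ← mul_pow]
        refine le_of_eq ?_
        rw [show (2 : ℝ≥0∞) = ENNReal.ofReal 2 by simp, ← ENNReal.ofReal_mul (by norm_num)]
        congr 2
        rw [pow_succ]
        field_simp
      abs := hν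
      aemeas := hf
      lower := fun n x hx => ae_toReal_essInf_le (hpos n x) (hbot n x hx)
      osc := hoscb
      diff := by
        intro n x hx
        have hcm : MeasurableSet (cellOf π n x) := hmeas _ _
        -- Cutting off outside the cell gives global integrability. The cells around y of generation
        -- m ≥ n stay inside, so the averages are unchanged.
        have hgi : ∫⁻ y, (cellOf π n x).indicator
            (fun y => ENNReal.ofReal (f y - b n (π n x))) y ≠ ∞ := by
          rw [lintegral_indicator hcm]
          exact ne_top_of_le_ne_top (ENNReal.mul_ne_top hMt (hfin n x)) (hoscb n x hx)
        have hleb := ae_tendsto_lintegral_halfOpenCube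
          ((hf.sub_const (b n (π n x))).ennreal_ofReal.indicator hcm) hgi
        rw [ae_restrict_iff' hcm]
        filter_upwards [hleb] with y hy hyn t ht
        have h1 := hy (fun m => ctr m y) (fun m => r / 2 ^ m) hside_lim hside (fun m => by
          rw [← hcell]; exact mem_cellOf_self π m y)
        rw [Set.indicator_of_mem hyn] at h1
        refine le_of_tendsto h1 ?_
        filter_upwards [Filter.eventually_ge_atTop n] with m hm
        rw [← hcell]
        have hsub : cellOf π m y ⊆ cellOf π n x := by
          rw [← cellOf_eq_of_mem hyn]; exact cellOf_anti hnest hm y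
        refine (ENNReal.div_le_iff (hpos m y) (hfin m y)).2 (le_trans (le_of_eq ?_) (ht m hm))
        exact setLIntegral_congr_fun (hmeas m (π m y)) fun z hz => Set.indicator_of_mem (hsub hz) _
      half := by
        intro n x hx S hS hSm h2
        have h1 := hhalf (ctr n x) _ (hside n) (hside' n) (hctr n x hx)
          (S ∩ cube (ctr n x) (r / 2 ^ n)) Set.inter_subset_right
          (hSm.inter (measurableSet_cube _ _)) (by
            rw [measure_congr (hae n x)]
            exact le_trans (by gcongr; exact Set.inter_subset_left) h2)
        rw [measure_congr (hν.ae_le (hae n x))] at h1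
        have h3 : (S ∩ cube (ctr n x) (r / 2 ^ n) : Set (E d)) =ᵐ[volume] S := by
          have := (Filter.EventuallyEq.refl (ae volume) S).inter (hae n x)
          rwa [Set.inter_eq_self_of_subset_left hS] at this
        rwa [measure_congr (hν.ae_le h3)] at h1 }
  have hx₀ : x₀ ∈ Q := mem_cellOf_self π 0 x₀
  have hQae : cube x₀ r =ᵐ[volume] Q := hQ' ▸ cube_ae_eq_halfOpenCube x₀ r
  rw [setLIntegral_lowerOsc_congr hν hQae, measure_congr (hν.ae_le hQae)]
  rw [measure_congr (hν.ae_le hQae)] at hνfin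
  have := hD.setLIntegral_rpow_le hp hM0 hMt (one_le_pow₀ (by norm_num)) (by simp) hτ0 hτ1 0 hx₀
    hνfin
  simp_rw [← hlow 0 x₀ hx₀] at this
  exact this

/-! ### Muckenhoupt condition in dual form -/

/-- The Muckenhoupt condition on the set `S` in its dual form, as an inequality between the average
of a function and its weighted `p`-th moment. -/
def MuckenhouptOn (p : ℝ) (ω : E d → ℝ) (K : ℝ≥0∞) (S : Set (E d)) : Prop :=
  ∀ h : E d → ℝ≥0∞, AEMeasurable h volume →
    (∫⁻ x in S, h x) ^ p * weightOf ω S ≤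
      K * volume S ^ p * ∫⁻ x in S, h x ^ p * ENNReal.ofReal (ω x)

theorem IsWeight.aemeasurable {ω : E d → ℝ} (hω : IsWeight ω) :
    AEMeasurable (fun x => ENNReal.ofReal (ω x)) volume :=
  hω.2.aestronglyMeasurable.aemeasurable.ennreal_ofReal

theorem weightOf_mono (ω : E d → ℝ) {S T : Set (E d)} (h : S ⊆ T) : weightOf ω S ≤ weightOf ω T :=
  lintegral_mono_set h

theorem IsWeight.weightOf_ball_ne_top {ω : E d → ℝ} (hω : IsWeight ω) (x : E d) (r : ℝ) :
    weightOf ω (Metric.ball x r) ≠ ∞ := by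
  rw [weightOf, ← ofReal_ballMass hω.1 hω.2]
  exact ENNReal.ofReal_ne_top

/-- For p = 1, replace ω under the integral by its essential infimum. -/
theorem muckenhouptOn_one {ω : E d → ℝ} {S : Set (E d)} (hS0 : volume S ≠ 0) (hSt : volume S ≠ ∞)
    {K : ℝ≥0∞}
    (hA : avg S (fun x => ENNReal.ofReal (ω x)) ≤
      K * essInf (fun x => ENNReal.ofReal (ω x)) (volume.restrict S)) :
    MuckenhouptOn 1 ω K S := by
  intro h hh
  simp only [ENNReal.rpow_one]
  set e := essInf (fun x => ENNReal.ofReal (ω x)) (volume.restrict S) with he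
  have h1 : weightOf ω S ≤ K * e * volume S := (ENNReal.div_le_iff hS0 hSt).1 hA
  have h2 : (∫⁻ x in S, h x) * e ≤ ∫⁻ x in S, h x * ENNReal.ofReal (ω x) := by
    rw [← lintegral_mul_const'' _ hh.restrict]
    refine lintegral_mono_ae ?_
    filter_upwards [ae_essInf_le (μ := volume.restrict S) (f := fun x => ENNReal.ofReal (ω x))]
      with x hx
    gcongr
  calc (∫⁻ x in S, h x) * weightOf ω S ≤ (∫⁻ x in S, h x) * (K * e * volume S) := by gcongr
    _ = K * volume S * ((∫⁻ x in S, h x) * e) := by ring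
    _ ≤ _ := by gcongr

/-- Hölder's inequality for h = (h ω^{1/p}) · ω^{-1/p}, whose dual factor is the integral of
ω^{-1/(p-1)} appearing in the Muckenhoupt product. -/
theorem muckenhouptOn_of_one_lt {ω : E d → ℝ} (hω : IsWeight ω) {S : Set (E d)}
    (hS0 : volume S ≠ 0) (hSt : volume S ≠ ∞) {p : ℝ} (hp : 1 < p) {K : ℝ≥0∞} (hK : K ≠ ∞)
    (hA : muckenhouptProduct p ω S ≤ K) : MuckenhouptOn p ω (K ^ p) S := by
  intro h hh
  have hp0 : 0 < p := by linarith
  have hp1 : 0 < p - 1 := by linarith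
  have hc : p.HolderConjugate (p / (p - 1)) := Real.HolderConjugate.conjExponent hp
  have hωm := hω.aemeasurable
  set w : E d → ℝ≥0∞ := fun x => ENNReal.ofReal (ω x) with hw
  set A := weightOf ω S with hAdef
  set D := ∫⁻ x in S, w x ^ (-(1 / (p - 1))) with hD
  have e1 : p / (p - 1) / p = 1 / (p - 1) := by field_simp
  have e2 : 1 / (p / (p - 1)) = (p - 1) / p := one_div_div _ _
  have hA' : (A / volume S) ^ (1 / p) * (D / volume S) ^ ((p - 1) / p) ≤ K := by
    have := hA
    rw [muckenhouptProduct, if_neg hp.ne', e1, e2] at this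
    exact this
  rcases eq_or_ne A 0 with hA0 | hA0
  · rw [hA0, mul_zero]; exact zero_le
  have hpow : A / volume S * (D / volume S) ^ (p - 1) ≤ K ^ p := by
    have := ENNReal.rpow_le_rpow hA' hp0.le
    rwa [ENNReal.mul_rpow_of_nonneg _ _ hp0.le, ← ENNReal.rpow_mul, ← ENNReal.rpow_mul,
      one_div_mul_cancel hp0.ne', div_mul_cancel₀ _ hp0.ne', ENNReal.rpow_one] at this
  -- As the weight of `S` is nonzero here, an infinite dual integral would violate the bound. Its
  -- finiteness forces ω > 0 a.e. on `S`, which the factorization of `h` requires.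
  have hDt : D ≠ ∞ := by
    intro htop
    rw [htop, ENNReal.top_div_of_ne_top hSt, ENNReal.top_rpow_of_pos hp1,
      ENNReal.mul_top (ENNReal.div_ne_zero.2 ⟨hA0, hSt⟩), top_le_iff] at hpow
    exact (ENNReal.rpow_lt_top_of_nonneg hp0.le hK).ne hpow
  have hwpos : ∀ᵐ x ∂volume.restrict S, w x ≠ 0 := by
    have := ae_lt_top' (hωm.restrict.pow_const _) hDt
    filter_upwards [this] with x hx h0
    rw [h0, ENNReal.zero_rpow_of_neg (by rw [neg_lt_zero]; positivity)] at hx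
    exact lt_irrefl _ hx
  have hHolder : ∫⁻ x in S, h x ≤ (∫⁻ x in S, h x ^ p * w x) ^ (1 / p) * D ^ ((p - 1) / p) := by
    have h1 := ENNReal.lintegral_mul_le_Lp_mul_Lq (volume.restrict S) hc
      (f := fun x => h x * w x ^ (1 / p)) (g := fun x => w x ^ (-(1 / p)))
      (hh.restrict.mul (hωm.restrict.pow_const _)) (hωm.restrict.pow_const _)
    rw [e2] at h1
    calc ∫⁻ x in S, h x = ∫⁻ x in S, (h x * w x ^ (1 / p)) * w x ^ (-(1 / p)) := by
          refine lintegral_congr_ae ?_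
          filter_upwards [hwpos] with x hx
          rw [mul_assoc, ← ENNReal.rpow_add _ _ hx ENNReal.ofReal_ne_top, add_neg_cancel,
            ENNReal.rpow_zero, mul_one]
      _ ≤ _ := h1
      _ = _ := by
          congr 2
          · refine lintegral_congr fun x => ?_
            rw [ENNReal.mul_rpow_of_nonneg _ _ hp0.le, ← ENNReal.rpow_mul,
              one_div_mul_cancel hp0.ne', ENNReal.rpow_one]
          · refine lintegral_congr fun x => ?_
            rw [← ENNReal.rpow_mul]
            congr 1
            field_simp
  have hHp : (∫⁻ x in S, h x) ^ p ≤ (∫⁻ x in S, h x ^ p * w x) * D ^ (p - 1) := by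
    have := ENNReal.rpow_le_rpow hHolder hp0.le
    rwa [ENNReal.mul_rpow_of_nonneg _ _ hp0.le, ← ENNReal.rpow_mul, ← ENNReal.rpow_mul,
      one_div_mul_cancel hp0.ne', div_mul_cancel₀ _ hp0.ne', ENNReal.rpow_one] at this
  have hAD : A * D ^ (p - 1) ≤ K ^ p * volume S ^ p := by
    have h3 : A * D ^ (p - 1) = A / volume S * (D / volume S) ^ (p - 1) * volume S ^ p := by
      have hv : volume S ^ p = volume S * volume S ^ (p - 1) := by
        nth_rw 2 [← ENNReal.rpow_one (volume S)]
        rw [← ENNReal.rpow_add _ _ hS0 hSt, add_sub_cancel]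
      calc A * D ^ (p - 1)
          = (A / volume S * volume S) * (D / volume S * volume S) ^ (p - 1) := by
            rw [ENNReal.div_mul_cancel hS0 hSt, ENNReal.div_mul_cancel hS0 hSt]
        _ = _ := by
            rw [hv, ENNReal.mul_rpow_of_nonneg _ (volume S) hp1.le]; ring
    rw [h3]
    gcongr
  calc (∫⁻ x in S, h x) ^ p * A ≤ ((∫⁻ x in S, h x ^ p * w x) * D ^ (p - 1)) * A := by gcongr
    _ = (A * D ^ (p - 1)) * ∫⁻ x in S, h x ^ p * w x := by ring
    _ ≤ _ := by gcongr

/-- The dual form carries the p-th power of the constant, hence the exponent θp. Enlarging the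
constant to be at least 1 prepares for `weightOf_le_of_two_mul_le`. -/
theorem MemA.exists_muckenhouptOn {ρ : E d → ℝ} (hρ : ∀ x, 0 < ρ x) {θ p : ℝ} (hθ : 0 < θ)
    (hp : 1 ≤ p) {ω : E d → ℝ} (hω : MemA ρ θ p ω) :
    ∃ C η : ℝ, 1 ≤ C ∧ 0 < η ∧ ∀ (x : E d) (r : ℝ), 0 < r →
      MuckenhouptOn p ω (ENNReal.ofReal (C * (1 + r / ρ x) ^ η)) (Metric.ball x r) := by
  obtain ⟨hwt, C, hC, h⟩ := hω
  refine ⟨max 1 C ^ p, θ * p, Real.one_le_rpow (le_max_left _ _) (by linarith), by positivity,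
    fun x r hr => ?_⟩
  have hρx := hρ x
  have hB0 := (Metric.measure_ball_pos volume x hr).ne'
  have hBt : volume (Metric.ball x r) ≠ ∞ := measure_ball_lt_top.ne
  have hle : ENNReal.ofReal (C * (1 + r / ρ x) ^ θ) ≤
      ENNReal.ofReal (max 1 C * (1 + r / ρ x) ^ θ) := by
    gcongr
    exact le_max_right _ _
  have hpow : ENNReal.ofReal (max 1 C ^ p * (1 + r / ρ x) ^ (θ * p)) =
      ENNReal.ofReal (max 1 C * (1 + r / ρ x) ^ θ) ^ p := by
    rw [ENNReal.ofReal_rpow_of_nonneg (by positivity) (by linarith),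
      Real.mul_rpow (by positivity) (by positivity), Real.rpow_mul (by positivity)]
  have hx := h x r hr
  rw [hpow]
  rcases hp.eq_or_lt with heq | hlt
  · subst heq
    rw [if_pos rfl] at hx
    rw [ENNReal.rpow_one]
    exact muckenhouptOn_one hB0 hBt (hx.trans (by gcongr))
  · rw [if_neg hlt.ne'] at hx
    exact muckenhouptOn_of_one_lt hwt hB0 hBt hlt ENNReal.ofReal_ne_top (hx.trans hle)

section MuckenhouptOn

variable {p : ℝ} {ω : E d → ℝ} {K : ℝ≥0∞} {S : Set (E d)}

theorem MuckenhouptOn.indicator (hp : 0 < p) (h : MuckenhouptOn p ω K S) {T : Set (E d)}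
    (hTS : T ⊆ S) (hT : MeasurableSet T) {g : E d → ℝ≥0∞} (hg : AEMeasurable g volume) :
    (∫⁻ x in T, g x) ^ p * weightOf ω S ≤
      K * volume S ^ p * ∫⁻ x in T, g x ^ p * ENNReal.ofReal (ω x) := by
  have h1 := h (T.indicator g) (hg.indicator hT)
  have e2 : ∀ x, T.indicator g x ^ p * ENNReal.ofReal (ω x) =
      T.indicator (fun x => g x ^ p * ENNReal.ofReal (ω x)) x := by
    intro x
    by_cases hx : x ∈ T
    · simp [hx]
    · simp [hx, hp]
  simp_rw [e2] at h1
  rwa [lintegral_indicator hT, lintegral_indicator hT, Measure.restrict_restrict hT,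
    Set.inter_eq_self_of_subset_left hTS] at h1

/-- The test function is the indicator of `T`. This comparison of proportions yields doubling of the
weight, its positivity on balls, and the half-measure estimate. -/
theorem MuckenhouptOn.measure_rpow_mul_le (hp : 0 < p) (h : MuckenhouptOn p ω K S)
    {T : Set (E d)} (hTS : T ⊆ S) (hT : MeasurableSet T) :
    volume T ^ p * weightOf ω S ≤ K * volume S ^ p * weightOf ω T := by
  have := h.indicator hp hTS hT (g := fun _ => 1) aemeasurable_const
  simpa [weightOf] using this

/-- Test functions supported in `T` suffice, so the condition passes to subsets of comparable
volume; this transfers it from balls to cubes. -/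
theorem MuckenhouptOn.subset (hp : 0 < p) (h : MuckenhouptOn p ω K S) {T : Set (E d)}
    (hTS : T ⊆ S) (hT : MeasurableSet T) {c : ℝ≥0∞} (hc : volume S ≤ c * volume T) :
    MuckenhouptOn p ω (K * c ^ p) T := by
  intro g hg
  calc (∫⁻ x in T, g x) ^ p * weightOf ω T ≤ (∫⁻ x in T, g x) ^ p * weightOf ω S := by
        gcongr
        exact weightOf_mono ω hTS
    _ ≤ K * volume S ^ p * ∫⁻ x in T, g x ^ p * ENNReal.ofReal (ω x) := h.indicator hp hTS hT hg
    _ ≤ K * (c * volume T) ^ p * ∫⁻ x in T, g x ^ p * ENNReal.ofReal (ω x) := by gcongr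
    _ = _ := by rw [ENNReal.mul_rpow_of_nonneg _ _ hp.le]; ring

theorem MuckenhouptOn.mono (h : MuckenhouptOn p ω K S) {K' : ℝ≥0∞} (hK : K ≤ K') :
    MuckenhouptOn p ω K' S := fun g hg => (h g hg).trans (by gcongr)

/-- The average of a function is controlled by its weighted `L^p` average. -/
theorem MuckenhouptOn.avg_le (hp : 0 < p) (h : MuckenhouptOn p ω K S) (hS0 : volume S ≠ 0)
    (hSt : volume S ≠ ∞) (hω0 : weightOf ω S ≠ 0) (hωt : weightOf ω S ≠ ∞) {g : E d → ℝ≥0∞}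
    (hg : AEMeasurable g volume) :
    avg S g ≤ K ^ (1 / p) *
      ((∫⁻ x in S, g x ^ p * ENNReal.ofReal (ω x)) / weightOf ω S) ^ (1 / p) := by
  have h1 := h g hg
  rw [← ENNReal.mul_rpow_of_nonneg _ _ (by positivity), ← ENNReal.rpow_le_rpow_iff hp,
    ← ENNReal.rpow_mul, one_div_mul_cancel hp.ne', ENNReal.rpow_one, avg,
    ENNReal.div_rpow_of_nonneg _ _ hp.le, ENNReal.div_le_iff (by simp [hS0, hSt])
    (by simp [hS0, hSt]), ← mul_div_assoc, ENNReal.mul_comm_div, ← mul_div_assoc,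
    ENNReal.le_div_iff_mul_le (Or.inl hω0) (Or.inl hωt)]
  exact h1.trans (le_of_eq (by ring))

/-- A subset of at most half the measure misses a fixed proportion of the weight. -/
theorem MuckenhouptOn.weightOf_le_of_two_mul_le (hp : 1 ≤ p) {k : ℝ} (hk : 1 ≤ k)
    (h : MuckenhouptOn p ω (ENNReal.ofReal k) S) (hSm : MeasurableSet S) (hS0 : volume S ≠ 0)
    (hSt : volume S ≠ ∞) (hωt : weightOf ω S ≠ ∞) {T : Set (E d)} (hTS : T ⊆ S)
    (hT : MeasurableSet T) (h2 : 2 * volume T ≤ volume S) :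
    weightOf ω T ≤ ENNReal.ofReal (1 - (p * (2 ^ p * k))⁻¹) ^ p * weightOf ω S := by
  have hp0 : 0 < p := by linarith
  set L : ℝ := 2 ^ p * k with hL
  have hL1 : 1 ≤ L := one_le_mul_of_one_le_of_one_le (Real.one_le_rpow (by norm_num) hp0.le) hk
  have hvol : volume S ≤ 2 * volume (S \ T) := by
    have h3 : volume S = volume T + volume (S \ T) := by
      rw [← measure_inter_add_sdiff S hT, Set.inter_eq_self_of_subset_right hTS]
    have hTt : volume T ≠ ∞ := ne_top_of_le_ne_top hSt (measure_mono hTS)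
    rw [h3, two_mul] at h2
    have h4 := ENNReal.le_of_add_le_add_left hTt h2
    calc volume S = volume T + volume (S \ T) := h3
      _ ≤ volume (S \ T) + volume (S \ T) := by gcongr
      _ = _ := (two_mul _).symm
  have h5 : weightOf ω S ≤ ENNReal.ofReal L * weightOf ω (S \ T) := by
    have h6 := h.measure_rpow_mul_le hp0 Set.sdiff_subset (hSm.diff hT)
    have h7 : volume S ^ p * weightOf ω S ≤
        volume S ^ p * (ENNReal.ofReal L * weightOf ω (S \ T)) := by
      calc volume S ^ p * weightOf ω S ≤ (2 * volume (S \ T)) ^ p * weightOf ω S := by gcongr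
        _ = 2 ^ p * (volume (S \ T) ^ p * weightOf ω S) := by
            rw [ENNReal.mul_rpow_of_nonneg _ _ hp0.le, mul_assoc]
        _ ≤ 2 ^ p * (ENNReal.ofReal k * volume S ^ p * weightOf ω (S \ T)) := by gcongr
        _ = _ := by
            rw [hL, ENNReal.ofReal_mul (by positivity), ← ENNReal.ofReal_rpow_of_nonneg (by norm_num)
              hp0.le, ENNReal.ofReal_ofNat]
            ring
    exact (ENNReal.mul_le_mul_iff_right (by simp [hS0, hSt]) (by simp [hS0, hSt])).1
      h7
  have hsplit : weightOf ω S = weightOf ω T + weightOf ω (S \ T) := by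
    unfold weightOf
    rw [← lintegral_inter_add_sdiff _ S hT, Set.inter_eq_self_of_subset_right hTS]
  have hTt : weightOf ω T ≠ ∞ := ne_top_of_le_ne_top hωt (weightOf_mono ω hTS)
  have hDt : weightOf ω (S \ T) ≠ ∞ := ne_top_of_le_ne_top hωt (weightOf_mono ω Set.sdiff_subset)
  -- The complement of `T` has at least half the volume, hence at least 1/L of the weight. Bernoulli
  -- turns the remaining 1 - 1/L into τ^p with 1 - τ = 1/(pL), so 1/(1-τ) is linear in k.
  have hBern : 1 - L⁻¹ ≤ (1 - (p * L)⁻¹) ^ p := by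
    have := one_add_mul_self_le_rpow_one_add (s := -(p * L)⁻¹) (by
      rw [neg_le_neg_iff]
      exact inv_le_one_of_one_le₀ (one_le_mul_of_one_le_of_one_le hp hL1)) hp
    rw [← sub_eq_add_neg] at this
    refine le_trans (le_of_eq ?_) this
    field_simp
    ring
  have hτ0 : 0 ≤ 1 - (p * L)⁻¹ := sub_nonneg.2
    (inv_le_one_of_one_le₀ (one_le_mul_of_one_le_of_one_le hp hL1))
  have h8 : weightOf ω T ≤ ENNReal.ofReal (1 - L⁻¹) * weightOf ω S := by
    rw [hsplit] at h5 ⊢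
    lift weightOf ω T to NNReal using hTt with t
    lift weightOf ω (S \ T) to NNReal using hDt with u
    rw [← ENNReal.ofReal_coe_nnreal (p := t), ← ENNReal.ofReal_coe_nnreal (p := u),
      ← ENNReal.ofReal_add t.coe_nonneg u.coe_nonneg] at h5 ⊢
    have hL0 : 0 ≤ 1 - L⁻¹ := sub_nonneg.2 (inv_le_one_of_one_le₀ hL1)
    rw [← ENNReal.ofReal_mul (by linarith), ENNReal.ofReal_le_ofReal_iff
      (mul_nonneg (by linarith) u.coe_nonneg)] at h5
    rw [← ENNReal.ofReal_mul hL0]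
    refine ENNReal.ofReal_le_ofReal ?_
    have h9 : L⁻¹ * ((t : ℝ) + u) ≤ u := by rw [inv_mul_le_iff₀ (by linarith)]; exact h5
    linarith
  refine h8.trans ?_
  rw [ENNReal.ofReal_rpow_of_nonneg hτ0 hp0.le]
  gcongr

end MuckenhouptOn

/-! ### Balls against cubes, nondegeneracy, absorption of constants -/

theorem ball_subset_cube (x : E d) (r : ℝ) : Metric.ball x (r / 2) ⊆ cube x r := by
  intro y hy i
  have h1 : ‖(y - x) i‖ ≤ ‖y - x‖ := PiLp.norm_apply_le (y - x) i
  rw [Metric.mem_ball, dist_eq_norm] at hy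
  simpa using h1.trans_lt hy

theorem dist_le_of_forall_abs_sub_le {x y : E d} {t : ℝ} (ht : 0 ≤ t)
    (h : ∀ i, |y i - x i| ≤ t) : dist y x ≤ d * t := by
  rw [EuclideanSpace.dist_eq]
  refine Real.sqrt_le_iff.2 ⟨by positivity, ?_⟩
  calc ∑ i, dist (y i) (x i) ^ 2 ≤ ∑ _i : Fin d, t ^ 2 := by
        refine Finset.sum_le_sum fun i _ => ?_
        rw [Real.dist_eq]
        exact pow_le_pow_left₀ (abs_nonneg _) (h i) 2
    _ = d * t ^ 2 := by simp
    _ ≤ (d * t) ^ 2 := by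
        rw [mul_pow]
        refine mul_le_mul_of_nonneg_right ?_ (sq_nonneg t)
        exact_mod_cast Nat.le_self_pow two_ne_zero d

theorem cube_subset_ball (hd : 0 < d) (x : E d) {r : ℝ} (hr : 0 < r) :
    cube x r ⊆ Metric.ball x (d * r) := by
  intro y hy
  have h1 := dist_le_of_forall_abs_sub_le (by positivity : 0 ≤ r / 2) fun i => (hy i).le
  rw [Metric.mem_ball]
  have hd' : (0 : ℝ) < d := by exact_mod_cast hd
  nlinarith [mul_pos hd' hr]

/-- The ratio of the volumes of a ball of radius `d * r` and a cube of side length `r`. -/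
def ballCubeRatio (d : ℕ) : ℝ≥0∞ := volume (Metric.ball (0 : E d) d)

theorem ballCubeRatio_ne_top : ballCubeRatio d ≠ ∞ := measure_ball_lt_top.ne

theorem volume_ball_eq_ballCubeRatio_mul (hd : 0 < d) (x : E d) {r : ℝ} (hr : 0 < r) :
    volume (Metric.ball x (d * r)) = ballCubeRatio d * volume (cube x r) := by
  have hd' : (0 : ℝ) < d := by exact_mod_cast hd
  rw [ballCubeRatio, volume_cube, volume_ball_eq x (by positivity), volume_ball_eq 0 hd', mul_pow,
    ENNReal.ofReal_mul (by positivity), ENNReal.ofReal_pow hr.le]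
  ring

theorem IsWeight.weightOf_cube_ne_top (hd : 0 < d) {ω : E d → ℝ} (hω : IsWeight ω) (x : E d)
    {r : ℝ} (hr : 0 < r) : weightOf ω (cube x r) ≠ ∞ :=
  ne_top_of_le_ne_top (hω.weightOf_ball_ne_top x (d * r))
    (weightOf_mono ω (cube_subset_ball hd x hr))

/-- A ball of zero weight would, by the comparison of proportions in larger concentric balls, have
only weightless enlargements, so ω would vanish a.e. -/
theorem weightOf_ball_ne_zero {ω : E d → ℝ} (hω : IsWeight ω) (hω0 : ¬ ω =ᵐ[volume] 0) {p : ℝ}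
    (hp : 0 < p) {K : E d → ℝ → ℝ≥0∞}
    (h : ∀ (x : E d) (r : ℝ), 0 < r → MuckenhouptOn p ω (K x r) (Metric.ball x r))
    (x : E d) {r : ℝ} (hr : 0 < r) : weightOf ω (Metric.ball x r) ≠ 0 := by
  intro hz
  refine hω0 ?_
  have h1 : ∀ᵐ y ∂(volume.restrict (⋃ n : ℕ, Metric.ball x n)), ω y = 0 := by
    rw [ae_restrict_iUnion_iff]
    intro n
    have hR : 0 < max r n := lt_max_of_lt_left hr
    have h2 := (h x (max r n) hR).measure_rpow_mul_le hp
      (Metric.ball_subset_ball (le_max_left _ _)) measurableSet_ball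
    rw [hz, mul_zero, nonpos_iff_eq_zero, mul_eq_zero] at h2
    have h3 : weightOf ω (Metric.ball x (max r n)) = 0 := by
      refine h2.resolve_left ?_
      simp [(Metric.measure_ball_pos volume x hr).ne', measure_ball_lt_top.ne]
    have h4 : weightOf ω (Metric.ball x n) = 0 := by
      refine le_antisymm ((weightOf_mono ω ?_).trans h3.le) zero_le
      exact Metric.ball_subset_ball (le_max_right _ _)
    rw [weightOf, lintegral_eq_zero_iff' hω.aemeasurable.restrict] at h4
    filter_upwards [h4] with y hy
    exact le_antisymm (ENNReal.ofReal_eq_zero.1 hy) (hω.1 y)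
  rw [Metric.iUnion_ball_nat, Measure.restrict_univ] at h1
  exact h1

/-- The unit ball alone gives a positive contribution: the average of ω is nonzero there, and its
second factor could vanish only if ω were infinite a.e. -/
theorem charConst_ne_zero {ρ : E d → ℝ} (hρ : ∀ x, 0 < ρ x) (θ : ℝ) {p : ℝ} (hp : 1 ≤ p)
    {ω : E d → ℝ} (hω : IsWeight ω) (hB : weightOf ω (Metric.ball 0 1) ≠ 0) :
    charConst ρ θ p ω ≠ 0 := by
  have hρ0 := hρ 0
  have hvt : volume (Metric.ball (0 : E d) 1) ≠ ∞ := measure_ball_lt_top.ne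
  have hv0 : volume (Metric.ball (0 : E d) 1) ≠ 0 := (Metric.measure_ball_pos volume _ one_pos).ne'
  set B := Metric.ball (0 : E d) 1 with hBdef
  have havg : avg B (fun x => ENNReal.ofReal (ω x)) ≠ 0 := ENNReal.div_ne_zero.2 ⟨hB, hvt⟩
  have hres : (volume.restrict B) ≠ 0 := by simpa [Measure.restrict_eq_zero] using hv0
  have hm : muckenhouptProduct p ω B ≠ 0 := by
    unfold muckenhouptProduct
    split_ifs with h1
    · refine mul_ne_zero havg (ENNReal.inv_ne_zero.2 fun htop => ?_)
      have h2 := ae_essInf_le (μ := volume.restrict B) (f := fun x => ENNReal.ofReal (ω x))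
      rw [htop] at h2
      have := ae_neBot.2 hres
      obtain ⟨y, hy⟩ := h2.exists
      exact absurd hy (not_le.2 ENNReal.ofReal_lt_top)
    · have hp1 : 0 < p - 1 := sub_pos.2 (lt_of_le_of_ne hp (Ne.symm h1))
      have hp0 : 0 < p := by linarith
      have hpos : ∀ {a : ℝ≥0∞} {e : ℝ}, a ≠ 0 → 0 < e → a ^ e ≠ 0 := fun ha he => by
        rw [Ne, ENNReal.rpow_eq_zero_iff_of_pos he]; exact ha
      refine mul_ne_zero (hpos havg (by positivity)) (hpos ?_ (by positivity))
      refine ENNReal.div_ne_zero.2 ⟨fun h0 => ?_, hvt⟩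
      rw [lintegral_eq_zero_iff' (hω.aemeasurable.pow_const _).restrict] at h0
      have := ae_neBot.2 hres
      obtain ⟨y, hy⟩ := h0.exists
      rw [Pi.zero_apply, ENNReal.rpow_eq_zero_iff] at hy
      rcases hy with ⟨-, hy⟩ | ⟨hy, -⟩
      · have : 0 < p / (p - 1) / p := by positivity
        linarith
      · exact ENNReal.ofReal_ne_top hy
  have hle : ENNReal.ofReal ((1 + 1 / ρ 0) ^ (-θ)) * muckenhouptProduct p ω B ≤
      charConst ρ θ p ω := by
    unfold charConst
    exact le_iSup_of_le 0 (le_iSup_of_le 1 (le_iSup_of_le one_pos le_rfl))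
  refine fun h0 => mul_ne_zero ?_ hm (le_antisymm (hle.trans h0.le) zero_le)
  simp only [ne_eq, ENNReal.ofReal_eq_zero, not_le]
  positivity

/-- A finite nonzero factor can be absorbed in the constant of a polynomial bound. -/
theorem exists_bound_iff_exists_mul_bound {ρ : E d → ℝ} {X : ℝ≥0∞} (hX0 : X ≠ 0) (hXt : X ≠ ∞)
    (F : E d → ℝ → ℝ≥0∞) :
    (∃ C N : ℝ, 0 < C ∧ 0 < N ∧ ∀ (x₀ : E d) (r : ℝ), 0 < r →
        F x₀ r ≤ ENNReal.ofReal (C * (1 + r / ρ x₀) ^ N)) ↔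
      ∃ C N : ℝ, 0 < C ∧ 0 < N ∧ ∀ (x₀ : E d) (r : ℝ), 0 < r →
        F x₀ r ≤ ENNReal.ofReal C * X * ENNReal.ofReal ((1 + r / ρ x₀) ^ N) := by
  have hpos := ENNReal.toReal_pos hX0 hXt
  have hX : ∀ C : ℝ, 0 < C → ENNReal.ofReal C * X = ENNReal.ofReal (C * X.toReal) := fun C hC => by
    rw [ENNReal.ofReal_mul hC.le, ENNReal.ofReal_toReal hXt]
  constructor
  · rintro ⟨C, N, hC, hN, h⟩
    refine ⟨C / X.toReal, N, by positivity, hN, fun x r hr => (h x r hr).trans (le_of_eq ?_)⟩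
    rw [hX _ (by positivity), div_mul_cancel₀ _ hpos.ne', ENNReal.ofReal_mul hC.le]
  · rintro ⟨C, N, hC, hN, h⟩
    refine ⟨C * X.toReal, N, by positivity, hN, fun x r hr => (h x r hr).trans (le_of_eq ?_)⟩
    rw [hX _ hC]
    exact (ENNReal.ofReal_mul (by positivity)).symm

/-- f is its finite lower bound plus an integrable nonnegative part. This recovers the local
integrability that the weighted conditions do not presuppose. -/
theorem integrableOn_of_lintegral_lowerOsc_ne_top {f : E d → ℝ} (hf : AEMeasurable f volume)
    {S : Set (E d)} (hS0 : volume S ≠ 0) (hSt : volume S ≠ ∞)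
    (h : ∫⁻ y in S, lowerOsc f S y ≠ ∞) : IntegrableOn f S := by
  have hb := essInf_ne_bot_of_lintegral_ne_top hS0 h
  have hlow := ae_toReal_essInf_le hS0 hb
  simp_rw [lowerOsc_eq_ofReal hS0 hb] at h
  set b := (essInf (fun y => (f y : EReal)) (volume.restrict S)).toReal
  have h1 : IntegrableOn (fun y => f y - b) S := by
    refine ⟨(hf.sub_const b).restrict.aestronglyMeasurable, ?_⟩
    rw [hasFiniteIntegral_iff_ofReal]
    · exact h.lt_top
    · filter_upwards [hlow] with y hy
      exact sub_nonneg.2 hy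
  have h2 : IntegrableOn (fun _ : E d => b) S := integrableOn_const hSt
  exact (h1.add h2).congr (Filter.Eventually.of_forall fun y => sub_add_cancel (f y) b)

theorem locallyIntegrable_of_forall_ball {f : E d → ℝ}
    (h : ∀ x : E d, IntegrableOn f (Metric.ball x 1)) : LocallyIntegrable f :=
  fun x => ⟨Metric.ball x 1, Metric.ball_mem_nhds x one_pos, h x⟩

/-! ### Weighted characterizations for a general critical scale -/

section WeightedCharacterization

variable {ρ : E d → ℝ} {p : ℝ} {ω f : E d → ℝ}

/-- `ρ` is positive and the quantities `1 + r / ρ` at points of distance at most `r` are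
polynomially comparable. -/
def IsCriticalScale (ρ : E d → ℝ) : Prop :=
  (∀ x, 0 < ρ x) ∧ ∃ C N : ℝ, 0 < C ∧ 0 < N ∧ ∀ (x₀ x : E d) (r : ℝ), 0 < r → dist x x₀ ≤ r →
    1 + r / ρ x ≤ C * (1 + r / ρ x₀) ^ N

/-- The Muckenhoupt condition on all balls, with polynomial dependence on `1 + r / ρ`. -/
def IsPolyMuckenhoupt (ρ : E d → ℝ) (p : ℝ) (ω : E d → ℝ) : Prop :=
  ∃ C η : ℝ, 1 ≤ C ∧ 0 < η ∧ ∀ (x : E d) (r : ℝ), 0 < r →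
    MuckenhouptOn p ω (ENNReal.ofReal (C * (1 + r / ρ x) ^ η)) (Metric.ball x r)

theorem one_add_mul_div_le {ρ₀ κ r : ℝ} (hρ : 0 < ρ₀) (hκ : 1 ≤ κ) (hr : 0 < r) :
    1 + κ * r / ρ₀ ≤ κ * (1 + r / ρ₀) := by
  have : 0 < r / ρ₀ := by positivity
  rw [mul_add, mul_div_assoc]
  linarith

/-- The slack κ accommodates passages between balls and cubes, whose radii and centres change by
dimensional factors. -/
theorem IsCriticalScale.exists_le (hρ : IsCriticalScale ρ) {κ : ℝ} (hκ : 1 ≤ κ) :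
    ∃ C N : ℝ, 1 ≤ C ∧ 0 < N ∧ ∀ (x₀ z : E d) (r s : ℝ), 0 < r → s ≤ κ * r →
      dist z x₀ ≤ κ * r → 1 + s / ρ z ≤ C * (1 + r / ρ x₀) ^ N := by
  obtain ⟨hpos, C, N, hC, hN, h⟩ := hρ
  refine ⟨max 1 (C * κ ^ N), N, le_max_left _ _, hN, fun x₀ z r s hr hs hz => ?_⟩
  have hρ0 := hpos x₀
  have hρz := hpos z
  calc 1 + s / ρ z ≤ 1 + κ * r / ρ z := by gcongr
    _ ≤ C * (1 + κ * r / ρ x₀) ^ N := h x₀ z _ (by positivity) hz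
    _ ≤ C * (κ * (1 + r / ρ x₀)) ^ N := by
        gcongr
        exact one_add_mul_div_le hρ0 hκ hr
    _ = C * κ ^ N * (1 + r / ρ x₀) ^ N := by
        rw [Real.mul_rpow (by positivity) (by positivity)]; ring
    _ ≤ _ := by
        gcongr
        exact le_max_right _ _

theorem IsPolyMuckenhoupt.exists_cube (hd : 0 < d) (hρ : ∀ x, 0 < ρ x) (hp : 0 < p)
    (hω : IsPolyMuckenhoupt ρ p ω) :
    ∃ C η : ℝ, 1 ≤ C ∧ 0 < η ∧ ∀ (x : E d) (r : ℝ), 0 < r →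
      MuckenhouptOn p ω (ENNReal.ofReal (C * (1 + r / ρ x) ^ η)) (cube x r) := by
  obtain ⟨C, η, hC, hη, h⟩ := hω
  have hd1 : (1 : ℝ) ≤ d := by exact_mod_cast hd
  have hd0 : (0 : ℝ) < d := by linarith
  set c : ℝ := (ballCubeRatio d).toReal with hc
  have hc0 : 0 ≤ c := ENNReal.toReal_nonneg
  refine ⟨max 1 (C * (d : ℝ) ^ η * c ^ p), η, le_max_left _ _, hη, fun x r hr => ?_⟩
  have hρx := hρ x
  have h1 := (h x (d * r) (by positivity)).subset hp (cube_subset_ball hd x hr)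
    (measurableSet_cube x r) (volume_ball_eq_ballCubeRatio_mul hd x hr).le
  refine h1.mono ?_
  rw [← ENNReal.ofReal_toReal (ballCubeRatio_ne_top (d := d)), ← hc,
    ENNReal.ofReal_rpow_of_nonneg hc0 hp.le, ← ENNReal.ofReal_mul (by positivity)]
  refine ENNReal.ofReal_le_ofReal ?_
  calc C * (1 + d * r / ρ x) ^ η * c ^ p ≤ C * (d * (1 + r / ρ x)) ^ η * c ^ p := by
        gcongr
        exact one_add_mul_div_le hρx hd1 hr
    _ = (C * (d : ℝ) ^ η * c ^ p) * (1 + r / ρ x) ^ η := by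
        rw [Real.mul_rpow (by positivity) (by positivity)]; ring
    _ ≤ _ := by
        gcongr
        exact le_max_right _ _

theorem withDensity_apply_eq_weightOf (ω : E d → ℝ) {S : Set (E d)} (hS : MeasurableSet S) :
    volume.withDensity (fun x => ENNReal.ofReal (ω x)) S = weightOf ω S :=
  withDensity_apply _ hS

/-- The weighted John–Nirenberg inequality on cubes, with polynomial dependence of the constant on
`1 + r / ρ`. -/
theorem IsPolyMuckenhoupt.exists_weightedOsc_cube_le (hd : 0 < d) (hρ : IsCriticalScale ρ)
    (hp : 1 ≤ p) (hwt : IsWeight ω) (hω : IsPolyMuckenhoupt ρ p ω) :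
    ∃ C N : ℝ, 0 < C ∧ 0 < N ∧ ∀ f : E d → ℝ, AEMeasurable f volume → ∀ (x₀ : E d) (r M : ℝ),
      0 < r → 0 < M →
      (∀ (z : E d) (s : ℝ), 0 < s → s ≤ r → (∀ i, |z i - x₀ i| ≤ r / 2) →
        avg (cube z s) (lowerOsc f (cube z s)) ≤ ENNReal.ofReal M) →
      weightedOsc p ω f (cube x₀ r) ≤ ENNReal.ofReal (C * (1 + r / ρ x₀) ^ N * M) := by
  have hp0 : 0 < p := by linarith
  have hd1 : (1 : ℝ) ≤ d := by exact_mod_cast hd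
  obtain ⟨C₁, η, hC₁, hη, hmuck⟩ := hω.exists_cube hd hρ.1 hp0
  obtain ⟨C₂, N₂, hC₂, hN₂, hscale⟩ := hρ.exists_le hd1
  -- 4 · 2^d comes from the dyadic inequality with doubling constant 2^d; the rest is 1/(1-τ) = p
  -- 2^p k, where k = C₁(C₂Ψ^{N₂})^η is a Muckenhoupt constant valid on all the subcubes.
  refine ⟨4 * 2 ^ d * (p * (2 ^ p * (C₁ * C₂ ^ η))), N₂ * η, by positivity, by positivity,
    fun f hf x₀ r M hr hM hosc => ?_⟩
  have hρ0 := hρ.1 x₀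
  set Ψ := 1 + r / ρ x₀ with hΨ
  have hΨ1 : 1 ≤ Ψ := le_add_of_nonneg_right (by positivity)
  set k : ℝ := C₁ * (C₂ * Ψ ^ N₂) ^ η with hk
  have hCΨ : 1 ≤ C₂ * Ψ ^ N₂ := one_le_mul_of_one_le_of_one_le hC₂ (Real.one_le_rpow hΨ1 hN₂.le)
  have hk1 : 1 ≤ k := one_le_mul_of_one_le_of_one_le hC₁ (Real.one_le_rpow hCΨ hη.le)
  have hkeq : k = C₁ * C₂ ^ η * Ψ ^ (N₂ * η) := by
    rw [hk, Real.mul_rpow (by positivity) (by positivity), ← Real.rpow_mul (by positivity)]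
    ring
  have hL1 : 1 ≤ p * (2 ^ p * k) := one_le_mul_of_one_le_of_one_le hp
    (one_le_mul_of_one_le_of_one_le (Real.one_le_rpow (by norm_num) hp0.le) hk1)
  have hsub : ∀ (z : E d) (s : ℝ), 0 < s → s ≤ r → (∀ i, |z i - x₀ i| ≤ r / 2) →
      MuckenhouptOn p ω (ENNReal.ofReal k) (cube z s) := by
    intro z s hs hsr hz
    have hdist : dist z x₀ ≤ d * r :=
      (dist_le_of_forall_abs_sub_le (by positivity) hz).trans (by gcongr; linarith)
    have h1 := hscale x₀ z r s hr (by nlinarith) hdist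
    refine (hmuck z s hs).mono (ENNReal.ofReal_le_ofReal ?_)
    have hρz := hρ.1 z
    rw [hk]
    gcongr
  set ν := volume.withDensity (fun x => ENNReal.ofReal (ω x)) with hν
  have hνac : ν ≪ volume := withDensity_absolutelyContinuous _ _
  have hJN := setLIntegral_cube_lowerOsc_rpow_le (x₀ := x₀) hr hf hνac
    (by rw [hν, withDensity_apply_eq_weightOf ω (measurableSet_cube _ _)]
        exact hwt.weightOf_cube_ne_top hd x₀ hr)
    (M := ENNReal.ofReal M) (τ := 1 - (p * (2 ^ p * k))⁻¹) hp (by simpa using hM)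
    ENNReal.ofReal_ne_top (sub_nonneg.2 (inv_le_one_of_one_le₀ hL1))
    (sub_lt_self _ (by positivity)) hosc (fun z s hs hsr hz T hT hTm h2 => by
      rw [hν, withDensity_apply_eq_weightOf ω hTm,
        withDensity_apply_eq_weightOf ω (measurableSet_cube _ _)]
      exact (hsub z s hs hsr hz).weightOf_le_of_two_mul_le hp hk1 (measurableSet_cube _ _)
        (volume_cube_ne_zero z hs) (volume_cube_ne_top z s) (hwt.weightOf_cube_ne_top hd z hs)
        hT hTm h2)
  rw [sub_sub_cancel, inv_inv, hν, withDensity_apply_eq_weightOf ω (measurableSet_cube _ _),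
    restrict_withDensity (measurableSet_cube _ _), lintegral_withDensity_eq_lintegral_mul₀
      hwt.aemeasurable.restrict ((aemeasurable_lowerOsc hf _).pow_const p).restrict] at hJN
  simp only [Pi.mul_apply, mul_comm (ENNReal.ofReal (ω _))] at hJN
  have h4 : (4 : ℝ≥0∞) * 2 ^ d * ENNReal.ofReal M * ENNReal.ofReal (p * (2 ^ p * k)) =
      ENNReal.ofReal (4 * 2 ^ d * (p * (2 ^ p * (C₁ * C₂ ^ η))) * Ψ ^ (N₂ * η) * M) := by
    have h5 : (4 : ℝ≥0∞) * 2 ^ d = ENNReal.ofReal (4 * 2 ^ d) := by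
      rw [ENNReal.ofReal_mul (by norm_num), ENNReal.ofReal_pow (by norm_num)]
      simp
    rw [h5, ← ENNReal.ofReal_mul (by positivity), ← ENNReal.ofReal_mul (by positivity), hkeq]
    congr 1
    ring
  rw [h4] at hJN
  unfold weightedOsc
  refine (ENNReal.rpow_le_rpow (ENNReal.div_le_of_le_mul hJN) (by positivity)).trans (le_of_eq ?_)
  rw [← ENNReal.rpow_mul, mul_one_div_cancel hp0.ne', ENNReal.rpow_one]

theorem MuckenhouptOn.avg_lowerOsc_le {S : Set (E d)} {K : ℝ≥0∞} (hp : 0 < p)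
    (h : MuckenhouptOn p ω K S) (hS0 : volume S ≠ 0) (hSt : volume S ≠ ∞)
    (hω0 : weightOf ω S ≠ 0) (hωt : weightOf ω S ≠ ∞) (hf : AEMeasurable f volume) :
    avg S (lowerOsc f S) ≤ K ^ (1 / p) * weightedOsc p ω f S :=
  h.avg_le hp hS0 hSt hω0 hωt (aemeasurable_lowerOsc hf S)

theorem lintegral_ne_top_of_avg_le {S : Set (E d)} {g : E d → ℝ≥0∞} (hSt : volume S ≠ ∞)
    (hS0 : volume S ≠ 0) {A : ℝ≥0∞} (hA : A ≠ ∞) (h : avg S g ≤ A) : ∫⁻ y in S, g y ≠ ∞ :=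
  ne_top_of_le_ne_top (ENNReal.mul_ne_top hA hSt) ((ENNReal.div_le_iff hS0 hSt).1 h)

theorem ofReal_rpow_one_div_mul {C D η N Ψ : ℝ} (hC : 0 ≤ C) (hΨ : 0 < Ψ) (hp : 0 < p) :
    ENNReal.ofReal (C * Ψ ^ η) ^ (1 / p) * ENNReal.ofReal (D * Ψ ^ N) =
      ENNReal.ofReal (C ^ (1 / p) * D * Ψ ^ (η * (1 / p) + N)) := by
  rw [ENNReal.ofReal_rpow_of_nonneg (by positivity) (by positivity),
    ← ENNReal.ofReal_mul (by positivity), Real.mul_rpow hC (by positivity),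
    ← Real.rpow_mul hΨ.le, Real.rpow_add hΨ]
  congr 1
  ring

/-- The weighted characterization of `BLO_{ρ,∞}`. -/
theorem IsPolyMuckenhoupt.memBLOInf_iff (hd : 0 < d) (hρ : IsCriticalScale ρ) (hp : 1 ≤ p)
    (hwt : IsWeight ω) (hω0 : ¬ ω =ᵐ[volume] 0) (hω : IsPolyMuckenhoupt ρ p ω)
    (hf : AEMeasurable f volume) :
    MemBLOInf ρ f ↔ ∃ C N : ℝ, 0 < C ∧ 0 < N ∧ ∀ (x₀ : E d) (r : ℝ), 0 < r →
      weightedOsc p ω f (cube x₀ r) ≤ ENNReal.ofReal (C * (1 + r / ρ x₀) ^ N) := by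
  have hp0 : 0 < p := by linarith
  have hd1 : (1 : ℝ) ≤ d := by exact_mod_cast hd
  constructor
  · rintro ⟨θ, hθ, -, Cf, hCf, h⟩
    obtain ⟨C, N, hC, hN, hJN⟩ := hω.exists_weightedOsc_cube_le hd hρ hp hwt
    obtain ⟨C₂, N₂, hC₂, hN₂, hscale⟩ := hρ.exists_le hd1
    refine ⟨C * (Cf * C₂ ^ θ), N + N₂ * θ, by positivity, by positivity, fun x₀ r hr => ?_⟩
    have hρ0 := hρ.1 x₀
    have hΨ : 0 < 1 + r / ρ x₀ := by positivity
    -- Slow variation of ρ replaces the bounds at the centres z of the subcubes by a single M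
    -- expressed at x₀.
    refine (hJN f hf x₀ r (Cf * (C₂ * (1 + r / ρ x₀) ^ N₂) ^ θ) hr (by positivity)
      fun z s hs hsr hz => ?_).trans (le_of_eq ?_)
    · have hdist : dist z x₀ ≤ d * r :=
        (dist_le_of_forall_abs_sub_le (by positivity) hz).trans (by gcongr; linarith)
      have h1 := hscale x₀ z r s hr (by nlinarith) hdist
      have hρz := hρ.1 z
      refine (h z s hs).trans (ENNReal.ofReal_le_ofReal ?_)
      gcongr
    · congr 1
      rw [Real.mul_rpow (by positivity) (by positivity), ← Real.rpow_mul hΨ.le,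
        Real.rpow_add hΨ]
      ring
  · rintro ⟨C, N, hC, hN, h⟩
    obtain ⟨C₁, η, hC₁, hη, hmuck⟩ := hω.exists_cube hd hρ.1 hp0
    obtain ⟨C₀, η₀, -, -, hball⟩ := hω
    have key : ∀ (x₀ : E d) (r : ℝ), 0 < r → avg (cube x₀ r) (lowerOsc f (cube x₀ r)) ≤
        ENNReal.ofReal (C₁ ^ (1 / p) * C * (1 + r / ρ x₀) ^ (η * (1 / p) + N)) := by
      intro x₀ r hr
      have hρ0 := hρ.1 x₀
      have hne : weightOf ω (cube x₀ r) ≠ 0 := fun h0 =>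
        weightOf_ball_ne_zero hwt hω0 hp0 hball x₀ (half_pos hr)
          (le_antisymm ((weightOf_mono ω (ball_subset_cube x₀ r)).trans h0.le) zero_le)
      rw [← ofReal_rpow_one_div_mul (by positivity) (by positivity) hp0]
      refine ((hmuck x₀ r hr).avg_lowerOsc_le hp0 (volume_cube_ne_zero _ hr)
        (volume_cube_ne_top _ _) hne (hwt.weightOf_cube_ne_top hd x₀ hr) hf).trans ?_
      gcongr
      exact h x₀ r hr
    refine ⟨η * (1 / p) + N, by positivity, locallyIntegrable_of_forall_ball fun x => ?_,
      C₁ ^ (1 / p) * C, by positivity, key⟩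
    -- The cube of side 2 contains the unit ball.
    have hint := integrableOn_of_lintegral_lowerOsc_ne_top hf
      (volume_cube_ne_zero x (two_pos : (0 : ℝ) < 2)) (volume_cube_ne_top x 2)
      (lintegral_ne_top_of_avg_le (volume_cube_ne_top x 2) (volume_cube_ne_zero x two_pos)
        ENNReal.ofReal_ne_top (key x 2 two_pos))
    refine hint.mono_set ?_
    have := ball_subset_cube x 2
    rwa [div_self two_ne_zero] at this

theorem volume_ball_mul_eq (x : E d) {κ r : ℝ} (hκ : 0 < κ) (hr : 0 < r) :
    volume (Metric.ball x (κ * r)) = ENNReal.ofReal (κ ^ d) * volume (Metric.ball x r) := by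
  rw [volume_ball_eq x (mul_pos hκ hr), volume_ball_eq x hr, mul_pow,
    ENNReal.ofReal_mul (by positivity), mul_assoc]

/-- The comparison of proportions between concentric balls is doubling of the weight, with a
polynomial constant. -/
theorem IsPolyMuckenhoupt.exists_weightOf_ball_mul_le (hρ : ∀ x, 0 < ρ x) (hp : 0 < p)
    (hω : IsPolyMuckenhoupt ρ p ω) {κ : ℝ} (hκ : 1 ≤ κ) :
    ∃ C η : ℝ, 0 < C ∧ 0 < η ∧ ∀ (x : E d) (r : ℝ), 0 < r →
      weightOf ω (Metric.ball x (κ * r)) ≤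
        ENNReal.ofReal (C * (1 + r / ρ x) ^ η) * weightOf ω (Metric.ball x r) := by
  obtain ⟨C, η, hC, hη, h⟩ := hω
  have hκ0 : 0 < κ := by linarith
  refine ⟨C * κ ^ η * (κ ^ d) ^ p, η, by positivity, hη, fun x r hr => ?_⟩
  have hρx := hρ x
  have hB0 := (Metric.measure_ball_pos volume x hr).ne'
  have hBt : volume (Metric.ball x r) ≠ ∞ := measure_ball_lt_top.ne
  have h1 := (h x (κ * r) (by positivity)).measure_rpow_mul_le hp
    (Metric.ball_subset_ball (by nlinarith : r ≤ κ * r)) measurableSet_ball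
  rw [volume_ball_mul_eq x hκ0 hr, ENNReal.mul_rpow_of_nonneg _ _ hp.le] at h1
  refine (ENNReal.mul_le_mul_iff_right (a := volume (Metric.ball x r) ^ p) (by simp [hB0, hBt])
    (by simp [hB0, hBt])).1 (h1.trans ?_)
  calc ENNReal.ofReal (C * (1 + κ * r / ρ x) ^ η) * (ENNReal.ofReal (κ ^ d) ^ p *
        volume (Metric.ball x r) ^ p) * weightOf ω (Metric.ball x r)
      = volume (Metric.ball x r) ^ p * (ENNReal.ofReal (C * (1 + κ * r / ρ x) ^ η) *
        ENNReal.ofReal ((κ ^ d) ^ p) * weightOf ω (Metric.ball x r)) := by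
        rw [ENNReal.ofReal_rpow_of_nonneg (by positivity) hp.le]; ring
    _ ≤ _ := by
        rw [← ENNReal.ofReal_mul (by positivity)]
        have h2 : C * (1 + κ * r / ρ x) ^ η * (κ ^ d) ^ p ≤
            C * κ ^ η * (κ ^ d) ^ p * (1 + r / ρ x) ^ η :=
          calc C * (1 + κ * r / ρ x) ^ η * (κ ^ d) ^ p
              ≤ C * (κ * (1 + r / ρ x)) ^ η * (κ ^ d) ^ p := by
                gcongr
                exact one_add_mul_div_le hρx hκ hr
            _ = _ := by rw [Real.mul_rpow (by positivity) (by positivity)]; ring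
        gcongr

theorem ball_subset_cube_two_mul (x : E d) (r : ℝ) : Metric.ball x r ⊆ cube x (2 * r) := by
  have := ball_subset_cube x (2 * r)
  rwa [mul_div_cancel_left₀ _ two_ne_zero] at this

/-- The weighted oscillation over a ball is controlled by that over the circumscribed cube. -/
theorem weightedOsc_le_of_subset (hp : 0 < p) {B Q : Set (E d)} (hBQ : B ⊆ Q)
    {K : ℝ≥0∞} (hQ0 : weightOf ω Q ≠ 0) (hQt : weightOf ω Q ≠ ∞)
    (hK : weightOf ω Q ≤ K * weightOf ω B) :
    weightedOsc p ω f B ≤ K ^ (1 / p) * weightedOsc p ω f Q := by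
  unfold weightedOsc
  rw [← ENNReal.mul_rpow_of_nonneg _ _ (by positivity)]
  refine ENNReal.rpow_le_rpow (ENNReal.div_le_of_le_mul ?_) (by positivity)
  calc ∫⁻ x in B, lowerOsc f B x ^ p * ENNReal.ofReal (ω x)
      ≤ ∫⁻ x in Q, lowerOsc f Q x ^ p * ENNReal.ofReal (ω x) := by
        refine (lintegral_mono_set hBQ).trans (lintegral_mono fun x => ?_)
        gcongr
        exact lowerOsc_anti hBQ x
    _ = (∫⁻ x in Q, lowerOsc f Q x ^ p * ENNReal.ofReal (ω x)) / weightOf ω Q * weightOf ω Q :=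
        (ENNReal.div_mul_cancel hQ0 hQt).symm
    _ ≤ (∫⁻ x in Q, lowerOsc f Q x ^ p * ENNReal.ofReal (ω x)) / weightOf ω Q *
        (K * weightOf ω B) := by gcongr
    _ = _ := by ring

/-- The lower oscillation of a function in `C^{β,*}_{ρ,θ}` over a cube is controlled by that over
a ball containing it. -/
theorem avg_cube_lowerOsc_le (hd : 0 < d) {β : ℝ} (z : E d) {s : ℝ} (hs : 0 < s) {A v : ℝ≥0∞}
    (hβ : 0 ≤ β / d)
    (h : (∫⁻ x in Metric.ball z (d * s), lowerOsc f (Metric.ball z (d * s)) x) /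
      volume (Metric.ball z (d * s)) ^ (1 + β / (d : ℝ)) ≤ A)
    (hv : volume (Metric.ball z (d * s)) ≤ v) :
    avg (cube z s) (lowerOsc f (cube z s)) ≤ ballCubeRatio d * v ^ (β / (d : ℝ)) * A := by
  have hd' : (0 : ℝ) < d := by exact_mod_cast hd
  have hb0 := (Metric.measure_ball_pos volume z (mul_pos hd' hs)).ne'
  have hbt : volume (Metric.ball z (d * s)) ≠ ∞ := measure_ball_lt_top.ne
  have hsub := cube_subset_ball hd z hs
  have hvol := volume_ball_eq_ballCubeRatio_mul hd z hs
  set b := Metric.ball z (d * s)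
  rw [ENNReal.div_le_iff (by simp [hb0, hbt]) (by
    exact (ENNReal.rpow_lt_top_of_nonneg (by positivity) hbt).ne)] at h
  refine ENNReal.div_le_of_le_mul ?_
  calc ∫⁻ x in cube z s, lowerOsc f (cube z s) x ≤ ∫⁻ x in b, lowerOsc f b x :=
        (lintegral_mono_set hsub).trans (lintegral_mono fun x => lowerOsc_anti hsub x)
    _ ≤ A * volume b ^ (1 + β / (d : ℝ)) := h
    _ = A * (ballCubeRatio d * volume (cube z s) * volume b ^ (β / (d : ℝ))) := by
        rw [ENNReal.rpow_add _ _ hb0 hbt, ENNReal.rpow_one, ← hvol]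
    _ ≤ A * (ballCubeRatio d * volume (cube z s) * v ^ (β / (d : ℝ))) := by gcongr
    _ = _ := by ring

/-- A subcube of side s ≤ 2r lies in a ball of radius ds, whose volume is at most a dimensional
multiple of that of B(x₀,r). Hence on the cube circumscribed to B(x₀,r) the function has lower
oscillation bounded by a polynomial multiple of |B|^{β/d}, and the John–Nirenberg inequality for
cubes applies. Doubling of the weight returns to the ball. -/
theorem IsPolyMuckenhoupt.weightedOsc_ball_le_of_memCampanatoStar (hd : 0 < d)
    (hρ : IsCriticalScale ρ) (hp : 1 ≤ p) (hwt : IsWeight ω) (hω0 : ¬ ω =ᵐ[volume] 0)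
    (hω : IsPolyMuckenhoupt ρ p ω) (hf : AEMeasurable f volume) {β : ℝ} (hβ : 0 < β)
    (h : MemCampanatoStarInf ρ β f) :
    ∃ C N : ℝ, 0 < C ∧ 0 < N ∧ ∀ (x₀ : E d) (r : ℝ), 0 < r →
      weightedOsc p ω f (Metric.ball x₀ r) / volume (Metric.ball x₀ r) ^ (β / (d : ℝ)) ≤
        ENNReal.ofReal (C * (1 + r / ρ x₀) ^ N) := by
  have hp0 : 0 < p := by linarith
  have hd1 : (1 : ℝ) ≤ d := by exact_mod_cast hd
  have hd0 : (0 : ℝ) < d := by linarith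
  obtain ⟨θ, hθ, -, Cf, hCf, h⟩ := h
  obtain ⟨C, N, hC, hN, hJN⟩ := hω.exists_weightedOsc_cube_le hd hρ hp hwt
  obtain ⟨C₂, N₂, hC₂, hN₂, hscale⟩ := hρ.exists_le (show (1 : ℝ) ≤ d * 2 by linarith)
  obtain ⟨C₃, η, hC₃, hη, hdoub⟩ := hω.exists_weightOf_ball_mul_le hρ.1 hp0
    (show (1 : ℝ) ≤ d * 2 by linarith)
  obtain ⟨C₀, η₀, -, -, hball⟩ := hω
  set e : ℝ := β / d with he
  have he0 : 0 < e := by positivity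
  set c : ℝ := (ballCubeRatio d).toReal with hc
  have hc0 : 0 < c := ENNReal.toReal_pos (Metric.measure_ball_pos volume _ hd0).ne'
    ballCubeRatio_ne_top
  set D : ℝ := c * (((d : ℝ) * 2) ^ d) ^ e * (Cf * C₂ ^ θ) with hD
  refine ⟨C₃ ^ (1 / p) * (C * 2 ^ N * D), η * (1 / p) + (N + N₂ * θ), by positivity,
    by positivity, fun x₀ r hr => ?_⟩
  have hρ0 := hρ.1 x₀
  set Ψ := 1 + r / ρ x₀ with hΨ
  have hΨ0 : 0 < Ψ := by positivity
  have hB0 := (Metric.measure_ball_pos volume x₀ hr).ne'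
  have hBt : volume (Metric.ball x₀ r) ≠ ∞ := measure_ball_lt_top.ne
  have hBQ := ball_subset_cube_two_mul x₀ r
  have hωB := weightOf_ball_ne_zero hwt hω0 hp0 hball x₀ hr
  set v : ℝ := (volume (Metric.ball x₀ r)).toReal with hv
  have hv0 : 0 < v := ENNReal.toReal_pos hB0 hBt
  have hvE : volume (Metric.ball x₀ r) = ENNReal.ofReal v := (ENNReal.ofReal_toReal hBt).symm
  have h2r : 0 < 2 * r := by positivity
  have hQ : weightedOsc p ω f (cube x₀ (2 * r)) ≤
      ENNReal.ofReal (C * (1 + 2 * r / ρ x₀) ^ N * (D * Ψ ^ (N₂ * θ) * v ^ e)) := by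
    refine hJN f hf x₀ (2 * r) _ h2r (by positivity) fun z s hs hsr hz => ?_
    have hdist : dist z x₀ ≤ d * 2 * r :=
      (dist_le_of_forall_abs_sub_le (by positivity) hz).trans (by nlinarith)
    have hds : d * s ≤ d * 2 * r := by
      rw [mul_assoc]
      gcongr
    have h1 := hscale x₀ z r (d * s) hr hds hdist
    have hρz := hρ.1 z
    have hvol : volume (Metric.ball z (d * s)) ≤ ENNReal.ofReal (((d : ℝ) * 2) ^ d * v) := by
      calc volume (Metric.ball z (d * s)) ≤ volume (Metric.ball z (d * 2 * r)) :=
            measure_mono (Metric.ball_subset_ball hds)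
        _ = _ := by
            rw [ENNReal.ofReal_mul (by positivity), ← hvE, ← volume_ball_mul_eq x₀ (by positivity) hr,
              volume_ball_eq z (by positivity), volume_ball_eq x₀ (by positivity)]
    refine (avg_cube_lowerOsc_le hd z hs he0.le (h z (d * s) (by positivity)) hvol).trans ?_
    rw [← ENNReal.ofReal_toReal (ballCubeRatio_ne_top (d := d)), ← hc,
      ENNReal.ofReal_rpow_of_nonneg (by positivity) he0.le, ← ENNReal.ofReal_mul hc0.le,
      ← ENNReal.ofReal_mul (by positivity)]
    refine ENNReal.ofReal_le_ofReal ?_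
    calc c * (((d : ℝ) * 2) ^ d * v) ^ e * (Cf * (1 + d * s / ρ z) ^ θ)
        ≤ c * (((d : ℝ) * 2) ^ d * v) ^ e * (Cf * (C₂ * Ψ ^ N₂) ^ θ) := by gcongr
      _ = _ := by
          rw [Real.mul_rpow (by positivity) hv0.le, Real.mul_rpow (by positivity) (by positivity),
            ← Real.rpow_mul hΨ0.le]
          ring
  have hQB : weightOf ω (cube x₀ (2 * r)) ≤
      ENNReal.ofReal (C₃ * Ψ ^ η) * weightOf ω (Metric.ball x₀ r) := by
    refine (weightOf_mono ω (cube_subset_ball hd x₀ h2r)).trans ?_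
    rw [← mul_assoc]
    exact hdoub x₀ r hr
  have hQ0 : weightOf ω (cube x₀ (2 * r)) ≠ 0 := fun h0 =>
    hωB (le_antisymm ((weightOf_mono ω hBQ).trans h0.le) zero_le)
  refine ENNReal.div_le_of_le_mul ((weightedOsc_le_of_subset hp0 hBQ hQ0
    (hwt.weightOf_cube_ne_top hd x₀ h2r) hQB).trans ?_)
  calc ENNReal.ofReal (C₃ * Ψ ^ η) ^ (1 / p) * weightedOsc p ω f (cube x₀ (2 * r))
      ≤ ENNReal.ofReal (C₃ * Ψ ^ η) ^ (1 / p) *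
        ENNReal.ofReal (C * (2 * Ψ) ^ N * (D * Ψ ^ (N₂ * θ) * v ^ e)) := by
        gcongr
        refine hQ.trans (ENNReal.ofReal_le_ofReal ?_)
        gcongr
        exact one_add_mul_div_le hρ0 one_le_two hr
    _ = ENNReal.ofReal (C₃ * Ψ ^ η) ^ (1 / p) *
        ENNReal.ofReal (C * 2 ^ N * D * Ψ ^ (N + N₂ * θ)) * ENNReal.ofReal (v ^ e) := by
        rw [mul_assoc (ENNReal.ofReal _ ^ (1 / p)), ← ENNReal.ofReal_mul (by positivity),
          Real.mul_rpow (by norm_num) hΨ0.le, Real.rpow_add hΨ0]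
        congr 2
        ring
    _ = _ := by
        rw [ofReal_rpow_one_div_mul hC₃.le hΨ0 hp0, hvE, ENNReal.ofReal_rpow_of_nonneg hv0.le he0.le]

/-- The weighted characterization of `C^{β,*}_{ρ,∞}`. -/
theorem IsPolyMuckenhoupt.memCampanatoStarInf_iff (hd : 0 < d) (hρ : IsCriticalScale ρ)
    (hp : 1 ≤ p) (hwt : IsWeight ω) (hω0 : ¬ ω =ᵐ[volume] 0) (hω : IsPolyMuckenhoupt ρ p ω)
    (hf : AEMeasurable f volume) {β : ℝ} (hβ : 0 < β) :
    MemCampanatoStarInf ρ β f ↔ ∃ C N : ℝ, 0 < C ∧ 0 < N ∧ ∀ (x₀ : E d) (r : ℝ), 0 < r →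
      weightedOsc p ω f (Metric.ball x₀ r) / volume (Metric.ball x₀ r) ^ (β / (d : ℝ)) ≤
        ENNReal.ofReal (C * (1 + r / ρ x₀) ^ N) := by
  refine ⟨hω.weightedOsc_ball_le_of_memCampanatoStar hd hρ hp hwt hω0 hf hβ, ?_⟩
  have hp0 : 0 < p := by linarith
  have hd0 : (0 : ℝ) < d := by exact_mod_cast hd
  rintro ⟨C, N, hC, hN, h⟩
  obtain ⟨C₁, η, hC₁, hη, hmuck⟩ := hω
  set e : ℝ := β / d with he
  have he0 : 0 < e := by positivity
  have key : ∀ (x₀ : E d) (r : ℝ), 0 < r →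
      (∫⁻ x in Metric.ball x₀ r, lowerOsc f (Metric.ball x₀ r) x) ≤
        ENNReal.ofReal (C₁ ^ (1 / p) * C * (1 + r / ρ x₀) ^ (η * (1 / p) + N)) *
          volume (Metric.ball x₀ r) ^ (1 + e) := by
    intro x₀ r hr
    have hρ0 := hρ.1 x₀
    have hB0 := (Metric.measure_ball_pos volume x₀ hr).ne'
    have hBt : volume (Metric.ball x₀ r) ≠ ∞ := measure_ball_lt_top.ne
    have h1 := (hmuck x₀ r hr).avg_lowerOsc_le hp0 hB0 hBt
      (weightOf_ball_ne_zero hwt hω0 hp0 hmuck x₀ hr) (hwt.weightOf_ball_ne_top x₀ r) hf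
    have h2 := h x₀ r hr
    rw [ENNReal.div_le_iff (by simp [hB0, hBt])
      (ENNReal.rpow_lt_top_of_nonneg he0.le hBt).ne] at h2
    rw [avg, ENNReal.div_le_iff hB0 hBt] at h1
    refine h1.trans ?_
    rw [← ofReal_rpow_one_div_mul (by positivity) (by positivity) hp0,
      ENNReal.rpow_add _ _ hB0 hBt, ENNReal.rpow_one]
    calc _ ≤ ENNReal.ofReal (C₁ * (1 + r / ρ x₀) ^ η) ^ (1 / p) *
          (ENNReal.ofReal (C * (1 + r / ρ x₀) ^ N) * volume (Metric.ball x₀ r) ^ e) *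
            volume (Metric.ball x₀ r) := by gcongr
      _ = _ := by ring
  refine ⟨η * (1 / p) + N, by positivity, locallyIntegrable_of_forall_ball fun x => ?_,
    C₁ ^ (1 / p) * C, by positivity, fun x₀ r hr => ENNReal.div_le_of_le_mul (key x₀ r hr)⟩
  refine integrableOn_of_lintegral_lowerOsc_ne_top hf
    (Metric.measure_ball_pos volume x one_pos).ne' measure_ball_lt_top.ne
    (ne_top_of_le_ne_top (ENNReal.mul_ne_top ENNReal.ofReal_ne_top ?_) (key x 1 one_pos))
  exact (ENNReal.rpow_lt_top_of_nonneg (by positivity) measure_ball_lt_top.ne).ne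

end WeightedCharacterization

end SchrodingerBLO

end

/-! ### The theorem for the critical radius of V -/

theorem mainTheorem8 (d : ℕ) (hd : 3 ≤ d) (s : ℝ≥0∞) (hs : (d : ℝ≥0∞) / 2 ≤ s)
    (V : SchrodingerBLO.E d → ℝ) (hV : SchrodingerBLO.ReverseHolder s V)
    (hV0 : ¬ V =ᵐ[volume] 0)
    (ρ : SchrodingerBLO.E d → ℝ) (hρ : ρ = SchrodingerBLO.criticalRadius V)
    (p : ℝ) (hp : 1 ≤ p)
    (ω : SchrodingerBLO.E d → ℝ) (hω : SchrodingerBLO.MemAInf ρ p ω)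
    (hω0 : ¬ ω =ᵐ[volume] 0)
    (f : SchrodingerBLO.E d → ℝ) (hf : AEMeasurable f volume) :
    ((SchrodingerBLO.MemBLOInf ρ f ↔
        ∃ C N : ℝ, 0 < C ∧ 0 < N ∧ ∀ (x₀ : SchrodingerBLO.E d) (r : ℝ), 0 < r →
          SchrodingerBLO.weightedOsc p ω f (SchrodingerBLO.cube x₀ r) ≤
            ENNReal.ofReal (C * (1 + r / ρ x₀) ^ N)) ∧
      (SchrodingerBLO.charConstInf ρ p ω ≠ ⊤ →
        (SchrodingerBLO.MemBLOInf ρ f ↔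
          ∃ C N : ℝ, 0 < C ∧ 0 < N ∧ ∀ (x₀ : SchrodingerBLO.E d) (r : ℝ), 0 < r →
            SchrodingerBLO.weightedOsc p ω f (SchrodingerBLO.cube x₀ r) ≤
              ENNReal.ofReal C * SchrodingerBLO.charConstInf ρ p ω *
                ENNReal.ofReal ((1 + r / ρ x₀) ^ N)))) ∧
    (∀ β : ℝ, 0 < β → β < 1 →
      (SchrodingerBLO.MemCampanatoStarInf ρ β f ↔
        ∃ C N : ℝ, 0 < C ∧ 0 < N ∧ ∀ (x₀ : SchrodingerBLO.E d) (r : ℝ), 0 < r →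
          SchrodingerBLO.weightedOsc p ω f (Metric.ball x₀ r) /
              volume (Metric.ball x₀ r) ^ (β / (d : ℝ)) ≤
            ENNReal.ofReal (C * (1 + r / ρ x₀) ^ N)) ∧
      (SchrodingerBLO.charConstInf ρ p ω ≠ ⊤ →
        (SchrodingerBLO.MemCampanatoStarInf ρ β f ↔
          ∃ C N : ℝ, 0 < C ∧ 0 < N ∧ ∀ (x₀ : SchrodingerBLO.E d) (r : ℝ), 0 < r →
            SchrodingerBLO.weightedOsc p ω f (Metric.ball x₀ r) /
                volume (Metric.ball x₀ r) ^ (β / (d : ℝ)) ≤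
              ENNReal.ofReal C * SchrodingerBLO.charConstInf ρ p ω *
                ENNReal.ofReal ((1 + r / ρ x₀) ^ N)))) := by
  have hd0 : 0 < d := by omega
  subst hρ
  have hscale : SchrodingerBLO.IsCriticalScale (SchrodingerBLO.criticalRadius V) :=
    ⟨hV.criticalRadius_pos hd hs hV0, hV.exists_one_add_div_criticalRadius_le hd hs hV0⟩
  obtain ⟨θ, hθ, hθω⟩ := hω
  have hwt : SchrodingerBLO.IsWeight ω := hθω.1
  have hmuck : SchrodingerBLO.IsPolyMuckenhoupt (SchrodingerBLO.criticalRadius V) p ω :=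
    hθω.exists_muckenhouptOn hscale.1 hθ hp
  -- Positivity is needed to divide the constant C by the characteristic constant.
  have hX0 : SchrodingerBLO.charConstInf (SchrodingerBLO.criticalRadius V) p ω ≠ 0 := by
    obtain ⟨C, η, -, -, hball⟩ := hmuck
    exact SchrodingerBLO.charConst_ne_zero hscale.1 _ hp hwt
      (SchrodingerBLO.weightOf_ball_ne_zero hwt hω0 (by linarith) hball 0 one_pos)
  have hBLO := hmuck.memBLOInf_iff hd0 hscale hp hwt hω0 hf
  refine ⟨⟨hBLO, fun hXt => hBLO.trans
    (SchrodingerBLO.exists_bound_iff_exists_mul_bound hX0 hXt _)⟩, fun β hβ _ => ?_⟩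
  have hCamp := hmuck.memCampanatoStarInf_iff hd0 hscale hp hwt hω0 hf hβ
  exact ⟨hCamp, fun hXt => hCamp.trans
    (SchrodingerBLO.exists_bound_iff_exists_mul_bound hX0 hXt _)⟩
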